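/- Let $s,s'\in\mathbb C^N$ be unit vectors with $\gamma:=|\langle s,s'\rangle|\in(0,1)$, let $\sigma>0$, $\gamma_s:=\frac1{2\sigma^2}$ (the symbol SNR) and $\delta:=\sqrt{1-\gamma^2}$. Let $$\mathcal P(r\mid s)=\frac1{(2\pi\sigma^2)^N}\int_0^{2\pi}\exp\Bigl(-\frac{\|r-e^{i\theta}s\|^2}{2\sigma^2}\Bigr)\frac{d\theta}{2\pi}$$ be the probability density of receiving $r\in\mathbb C^N$ (unknown uniform carrier phase, complex Gaussian noise of variance $\sigma^2$ per real coordinate) when $s$ is sent, and let $$P=\int_{\{r\,:\,\mathcal P(r\mid s')\ge\mathcal P(r\mid s)\}}\mathcal P(r\mid s)\,dr$$ be the pairwise error probability of deciding on $s'$ when $s$ was sent and the two signals are equiprobable. Let $\mathrm{erfc}(x)=\frac2{\sqrt\pi}\int_x^\infty e^{-t^2}dt$ and put $$P_0=\frac12\sqrt{\frac{\gamma}{1-\delta}}\;\mathrm{erfc}\Bigl(\frac{\sqrt{\gamma_s}\sqrt{1-\gamma}}{\sqrt2}\Bigr)-\frac1{2\sqrt{\pi\gamma\gamma_s}}\exp\Bigl(-\frac{\gamma_s(1-\gamma)}2\Bigr),$$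 $$P_1=\Bigl[\frac12\sqrt{\frac{\gamma}{1-\delta}}-\sqrt{\frac{1-\gamma}{\gamma}}\,\frac1{8\sqrt2}\Bigl(\frac{1+\delta}{\gamma}+3\Bigr)\Bigr]\mathrm{erfc}\Bigl(\frac{\sqrt{\gamma_s}\sqrt{1-\gamma}}{\sqrt2}\Bigr)+\frac1{8\sqrt\pi}\Bigl[\sqrt2\sqrt{\frac{1-\gamma}{1-\delta}}\,(\gamma\gamma_s)^{-1/2}-(\gamma\gamma_s)^{-3/2}\Bigr]\exp\Bigl(-\frac{\gamma_s(1-\gamma)}2\Bigr).$$ Then $P_0$ and $P_1$ are the zeroth and first order asymptotic approximations of $P$ as $x:=\gamma_s\gamma/2\to\infty$, uniformly in $\gamma\in(0,1)$, in the following sense: there are absolute constants $C,X>0$ (independent of $N,s,s',\sigma$) such that, whenever $x\ge X$, one has $P>0$ and $$\Bigl|\frac{P_k}{P}-1\Bigr|\le C\,\min\Bigl(x^{-k-1/2},\;\frac{x^{-k-1}}{\sqrt{1-\gamma}}\Bigr)\qquad(k=0,1).$$ In particular, for fixed $\gamma$, the relative error of $P_k$ is $O(\gamma_s^{-k-1})$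 as $\gamma_s\to\infty$. -/

import Mathlib

open MeasureTheory

/-- The likelihood of receiving the vector `r` (up to a phase that carries no information) when the
unit vector `s` was sent: the density of the complex Gaussian noise with variance `σ ^ 2` per real
coordinate, averaged over a uniformly distributed random carrier phase `θ`. -/
noncomputable def likelihood {N : ℕ} (σ : ℝ) (s r : EuclideanSpace ℂ (Fin N)) : ℝ :=
  1 / (2 * Real.pi * σ ^ 2) ^ N *
    ((1 / (2 * Real.pi)) * ∫ θ in (0 : ℝ)..(2 * Real.pi),
      Real.exp (-(‖r - Complex.exp (θ * Complex.I) • s‖ ^ 2 / (2 * σ ^ 2))))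

/-- The pairwise error decision region for two equiprobable signals: the set of received vectors
for which `s'` is at least as likely as `s`. -/
def errorRegion {N : ℕ} (σ : ℝ) (s s' : EuclideanSpace ℂ (Fin N)) :
    Set (EuclideanSpace ℂ (Fin N)) :=
  {r | likelihood σ s r ≤ likelihood σ s' r}

/-- The pairwise error probability: the probability of deciding on `s'` when `s` was sent, no other
signals being considered. The integral is taken with respect to the `2N`-dimensional Lebesgue
measure on `ℂ ^ N`. -/
noncomputable def pairwiseErrorProb {N : ℕ} (σ : ℝ) (s s' : EuclideanSpace ℂ (Fin N)) : ℝ :=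
  ∫ r in errorRegion σ s s', likelihood σ s r

/-- The symbol signal-to-noise ratio of signals of unit energy. -/
noncomputable def symbolSNR (σ : ℝ) : ℝ := 1 / (2 * σ ^ 2)

/-- The complementary error function. -/
noncomputable def erfc (x : ℝ) : ℝ :=
  2 / Real.sqrt Real.pi * ∫ t in Set.Ioi x, Real.exp (-t ^ 2)

/-- The zeroth order approximation, as a function of the modulus `γ` of the inner product of the
signals and of the symbol signal-to-noise ratio `γs`. -/
noncomputable def zerothOrderApprox (γ γs : ℝ) : ℝ :=
  let δ := Real.sqrt (1 - γ ^ 2)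
  1 / 2 * Real.sqrt (γ / (1 - δ)) * erfc (Real.sqrt γs * Real.sqrt (1 - γ) / Real.sqrt 2)
    - 1 / (2 * Real.sqrt (Real.pi * γ * γs)) * Real.exp (-(γs * (1 - γ) / 2))

/-- The first order approximation. -/
noncomputable def firstOrderApprox (γ γs : ℝ) : ℝ :=
  let δ := Real.sqrt (1 - γ ^ 2)
  (1 / 2 * Real.sqrt (γ / (1 - δ))
      - Real.sqrt ((1 - γ) / γ) * (1 / (8 * Real.sqrt 2)) * ((1 + δ) / γ + 3))
      * erfc (Real.sqrt γs * Real.sqrt (1 - γ) / Real.sqrt 2)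
    + 1 / (8 * Real.sqrt Real.pi)
      * (Real.sqrt 2 * Real.sqrt ((1 - γ) / (1 - δ)) * (γ * γs) ^ (-(1 / 2) : ℝ)
          - (γ * γs) ^ (-(3 / 2) : ℝ))
      * Real.exp (-(γs * (1 - γ) / 2))

/-! Write T for the SNR and δ = √(1 - γ²). Averaging over the phase turns each likelihood into a
common factor times I₀(2T|⟨s, r⟩|), and I₀ increases, so the error region is |⟨s, r⟩| ≤ |⟨s', r⟩|.
This set is invariant under phases, so the average drops out and P is a plain Gaussian measure
(`pairwiseErrorProb_eq_toReal_lintegral`).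

Let t complete s to an orthonormal basis of the plane of s and s'. Only the ratio w = ⟨t, r⟩ / ⟨s,
r⟩ matters. Seen by stereographic projection on the Riemann sphere, its density depends only on the
height, and the error region is a hemisphere bounded by a tilted great circle. Integrating along
meridians and parametrizing that circle by its own arc angle ψ gives the single integral of
`pairwiseErrorProb_eq_integral`, with integrand exp(-(T/2)(1 - γ cos ψ)) / (1 - γ cos ψ).

The rest is Laplace's method, uniform in γ. With u = sin(ψ/2) and c² = (1 - γ)/(2γ), the integrand
becomes a multiple of exp(-2xu²)/(c² + u²), and dψ/2 = du/√(1 - u²). Replacing 1/√(1 - u²) by 1 or 1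
+ u²/2 and integrating over the whole line costs a relative error O(1/x) or O(1/x²), uniformly in c,
because the decreasing Lorentzian factor can only lower the moments of u²
(`abs_angularIntegral_sub_integral_le`). The line integrals are explicit in terms of erfc(z), z =
c√(2x).

P₀ and P₁ differ from these main terms by exactly a multiple of a remainder in the asymptotic
expansion of erfc (`zeroth_sub_main`, `first_sub_main`). Each remainder is bounded both by a
constant times erfc(z) and by that divided by z; the two bounds produce the two entries of the
minimum. -/

/-! ### The decision region and the removal of the phase average. -/

/-- The integral `2π I₀(t)`, with `I₀` the modified Bessel function. -/
noncomputable def besselIntegral (t : ℝ) : ℝ :=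
  ∫ θ in (0 : ℝ)..(2 * Real.pi), Real.exp (t * Real.cos θ)

/-- Folding the second half period onto the first replaces exp by cosh, whose monotonicity in |t|
holds pointwise, whatever the sign of the cosine. -/
theorem besselIntegral_eq_integral_cosh (t : ℝ) :
    besselIntegral t = ∫ θ in (0 : ℝ)..Real.pi, 2 * Real.cosh (t * Real.cos θ) := by
  have h1 : Continuous fun θ : ℝ => Real.exp (t * Real.cos θ) := by fun_prop
  have h2 : Continuous fun θ : ℝ => Real.exp (-(t * Real.cos θ)) := by fun_prop
  have h3 : ∫ θ in (Real.pi)..(2 * Real.pi), Real.exp (t * Real.cos θ) =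
      ∫ θ in (0 : ℝ)..Real.pi, Real.exp (-(t * Real.cos θ)) := by
    have := intervalIntegral.integral_comp_add_right (a := 0) (b := Real.pi)
      (fun θ : ℝ => Real.exp (t * Real.cos θ)) Real.pi
    simp only [zero_add, Real.cos_add_pi, mul_neg] at this
    rw [this, two_mul]
  unfold besselIntegral
  rw [← intervalIntegral.integral_add_adjacent_intervals (h1.intervalIntegrable 0 Real.pi)
    (h1.intervalIntegrable _ _), h3, ← intervalIntegral.integral_add (h1.intervalIntegrable _ _)
    (h2.intervalIntegrable _ _)]
  refine intervalIntegral.integral_congr fun θ _ => ?_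
  simp only [Real.cosh_eq]
  ring

theorem besselIntegral_strictMonoOn : StrictMonoOn besselIntegral (Set.Ici 0) := by
  intro a ha b hb hab
  simp only [Set.mem_Ici] at ha hb
  rw [besselIntegral_eq_integral_cosh, besselIntegral_eq_integral_cosh]
  refine intervalIntegral.integral_lt_integral_of_continuousOn_of_le_of_exists_lt Real.pi_pos
    (by fun_prop) (by fun_prop) (fun θ _ => ?_) ⟨0, ⟨le_rfl, Real.pi_pos.le⟩, ?_⟩
  · have : Real.cosh (a * Real.cos θ) ≤ Real.cosh (b * Real.cos θ) := by
      rw [Real.cosh_le_cosh, abs_mul, abs_mul, abs_of_nonneg ha, abs_of_nonneg hb]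
      gcongr
    linarith
  · have : Real.cosh a < Real.cosh b := by
      rw [Real.cosh_lt_cosh, abs_of_nonneg ha, abs_of_nonneg hb]
      exact hab
    simpa using this

theorem integral_exp_re_rotate (T : ℝ) (w : ℂ) :
    ∫ θ in (0 : ℝ)..(2 * Real.pi), Real.exp (T * (Complex.exp (θ * Complex.I) * w).re) =
      besselIntegral (T * ‖w‖) := by
  have h1 : ∀ θ : ℝ, (Complex.exp (θ * Complex.I) * w).re = ‖w‖ * Real.cos (θ + w.arg) := by
    intro θ
    conv_lhs => rw [← Complex.norm_mul_exp_arg_mul_I w]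
    rw [mul_left_comm, ← Complex.exp_add, ← add_mul, ← Complex.ofReal_add, Complex.re_ofReal_mul,
      Complex.exp_ofReal_mul_I_re]
  have hp : Function.Periodic (fun θ : ℝ => Real.exp (T * ‖w‖ * Real.cos θ)) (2 * Real.pi) :=
    fun θ => by simp
  simp_rw [h1, ← mul_assoc]
  rw [intervalIntegral.integral_comp_add_right (fun θ : ℝ => Real.exp (T * ‖w‖ * Real.cos θ)),
    zero_add, add_comm (2 * Real.pi), hp.intervalIntegral_add_eq w.arg 0, zero_add]
  rfl

theorem symbolSNR_pos {σ : ℝ} (hσ : 0 < σ) : 0 < symbolSNR σ := by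
  unfold symbolSNR; positivity

section

variable {N : ℕ}

theorem likelihood_eq_integral (σ : ℝ) (s r : EuclideanSpace ℂ (Fin N)) :
    likelihood σ s r = (symbolSNR σ / Real.pi) ^ N * ((1 / (2 * Real.pi)) *
      ∫ θ in (0 : ℝ)..(2 * Real.pi),
        Real.exp (-symbolSNR σ * ‖r - Complex.exp (θ * Complex.I) • s‖ ^ 2)) := by
  unfold likelihood symbolSNR
  congr 1
  · rw [← one_div_pow]; congr 1; rw [div_div]; ring
  · congr 2; ext θ; congr 1; ring

/-- In the expansion of the squared distance the phase enters only through the real part of a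
rotated inner product, and the average over a full turn forgets its argument. -/
theorem likelihood_eq_besselIntegral (σ : ℝ) {s : EuclideanSpace ℂ (Fin N)} (hs : ‖s‖ = 1)
    (r : EuclideanSpace ℂ (Fin N)) :
    likelihood σ s r = (symbolSNR σ / Real.pi) ^ N * ((1 / (2 * Real.pi)) *
      (Real.exp (-symbolSNR σ * (‖r‖ ^ 2 + 1)) *
        besselIntegral (2 * symbolSNR σ * ‖inner ℂ s r‖))) := by
  rw [likelihood_eq_integral, norm_inner_symm, ← integral_exp_re_rotate]
  congr 2
  rw [← intervalIntegral.integral_const_mul]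
  refine intervalIntegral.integral_congr fun θ _ => ?_
  rw [← Real.exp_add, @norm_sub_sq ℂ, inner_smul_right, norm_smul, Complex.norm_exp_ofReal_mul_I, hs]
  congr 1
  simp only [RCLike.re_to_complex]
  ring

theorem mem_errorRegion_iff {σ : ℝ} (hσ : 0 < σ) {s s' : EuclideanSpace ℂ (Fin N)} (hs : ‖s‖ = 1)
    (hs' : ‖s'‖ = 1) (r : EuclideanSpace ℂ (Fin N)) :
    r ∈ errorRegion σ s s' ↔ ‖inner ℂ s r‖ ≤ ‖inner ℂ s' r‖ := by
  have hT := symbolSNR_pos hσ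
  have hpi := Real.pi_pos
  unfold errorRegion
  rw [Set.mem_ofPred_eq, likelihood_eq_besselIntegral σ hs, likelihood_eq_besselIntegral σ hs',
    mul_le_mul_iff_right₀ (by positivity), mul_le_mul_iff_right₀ (by positivity),
    mul_le_mul_iff_right₀ (by positivity), besselIntegral_strictMonoOn.le_iff_le
      (Set.mem_Ici.2 (by positivity)) (Set.mem_Ici.2 (by positivity)),
    mul_le_mul_iff_right₀ (by positivity)]

theorem continuous_likelihood (σ : ℝ) (s : EuclideanSpace ℂ (Fin N)) :
    Continuous (likelihood σ s) := by
  rw [funext (likelihood_eq_integral σ s)]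
  refine continuous_const.mul (continuous_const.mul ?_)
  exact intervalIntegral.continuous_parametric_intervalIntegral_of_continuous' (by fun_prop) _ _

theorem likelihood_nonneg {σ : ℝ} (hσ : 0 < σ) (s r : EuclideanSpace ℂ (Fin N)) :
    0 ≤ likelihood σ s r := by
  have hT := symbolSNR_pos hσ
  rw [likelihood_eq_integral]
  have : 0 ≤ ∫ θ in (0 : ℝ)..(2 * Real.pi),
        Real.exp (-symbolSNR σ * ‖r - Complex.exp (θ * Complex.I) • s‖ ^ 2) :=
    intervalIntegral.integral_nonneg (by positivity) fun _ _ => (Real.exp_pos _).le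
  positivity

/-- The passage to `lintegral` lets Tonelli swap the phase and space integrals without integrability
conditions. -/
theorem ofReal_likelihood {σ : ℝ} (hσ : 0 < σ) (s r : EuclideanSpace ℂ (Fin N)) :
    ENNReal.ofReal (likelihood σ s r) =
      ENNReal.ofReal ((symbolSNR σ / Real.pi) ^ N * (1 / (2 * Real.pi))) *
        ∫⁻ θ in Set.Ioc (0 : ℝ) (2 * Real.pi),
          ENNReal.ofReal (Real.exp (-symbolSNR σ * ‖r - Complex.exp (θ * Complex.I) • s‖ ^ 2)) := by
  have hT := symbolSNR_pos hσ
  have hc : Continuous fun θ : ℝ =>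
      Real.exp (-symbolSNR σ * ‖r - Complex.exp (θ * Complex.I) • s‖ ^ 2) := by fun_prop
  rw [likelihood_eq_integral, ← mul_assoc, ENNReal.ofReal_mul (by positivity),
    intervalIntegral.integral_of_le (by positivity), ofReal_integral_eq_lintegral_ofReal]
  · exact (hc.integrableOn_Icc).mono_set Set.Ioc_subset_Icc_self
  · exact ae_of_all _ fun _ => (Real.exp_pos _).le

/-- Multiplication by a complex number of modulus one, as a real linear isometry. -/
noncomputable def unitSMulEquiv {E : Type*} [NormedAddCommGroup E] [InnerProductSpace ℂ E]
    [InnerProductSpace ℝ E] [IsScalarTower ℝ ℂ E] (a : ℂ) (ha : ‖a‖ = 1) : E ≃ₗᵢ[ℝ] E where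
  toLinearEquiv := (LinearEquiv.smulOfNeZero ℂ E a (norm_ne_zero_iff.1 (by simp [ha]))).restrictScalars ℝ
  norm_map' x := by simp [norm_smul, ha]

theorem measurePreserving_unit_smul (a : ℂ) (ha : ‖a‖ = 1) :
    MeasurePreserving (fun r : EuclideanSpace ℂ (Fin N) => a • r) volume volume :=
  (unitSMulEquiv a ha).measurePreserving

theorem setLIntegral_norm_sub_unit_smul {f : ℝ → ENNReal} (hf : Continuous f)
    (s : EuclideanSpace ℂ (Fin N)) {S : Set (EuclideanSpace ℂ (Fin N))} (hS : MeasurableSet S)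
    (a : ℂ) (ha : ‖a‖ = 1) (hSa : ∀ r, a • r ∈ S ↔ r ∈ S) :
    ∫⁻ r in S, f ‖r - a • s‖ = ∫⁻ r in S, f ‖r - s‖ := by
  have hpre : (fun r : EuclideanSpace ℂ (Fin N) => a • r) ⁻¹' S = S := Set.ext hSa
  rw [← (measurePreserving_unit_smul a ha).setLIntegral_comp_preimage hS (by fun_prop), hpre]
  refine lintegral_congr fun r => ?_
  rw [← smul_sub, norm_smul, ha, one_mul]

/-- The pairwise error probability as a Gaussian integral without phase averaging. -/
theorem pairwiseErrorProb_eq_toReal_lintegral {σ : ℝ} (hσ : 0 < σ)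
    {s s' : EuclideanSpace ℂ (Fin N)} (hs : ‖s‖ = 1) (hs' : ‖s'‖ = 1) :
    pairwiseErrorProb σ s s' = (ENNReal.ofReal ((symbolSNR σ / Real.pi) ^ N) *
      ∫⁻ r in {r | ‖inner ℂ s r‖ ≤ ‖inner ℂ s' r‖},
        ENNReal.ofReal (Real.exp (-symbolSNR σ * ‖r - s‖ ^ 2))).toReal := by
  have hT := symbolSNR_pos hσ
  have hset : errorRegion σ s s' = {r | ‖inner ℂ s r‖ ≤ ‖inner ℂ s' r‖} :=
    Set.ext (mem_errorRegion_iff hσ hs hs')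
  have hmeas : MeasurableSet {r : EuclideanSpace ℂ (Fin N) | ‖inner ℂ s r‖ ≤ ‖inner ℂ s' r‖} :=
    (isClosed_le (by fun_prop) (by fun_prop)).measurableSet
  unfold pairwiseErrorProb
  rw [integral_eq_lintegral_of_nonneg_ae (ae_of_all _ fun r => likelihood_nonneg hσ s r)
    (continuous_likelihood σ s).aestronglyMeasurable, hset]
  congr 1
  simp_rw [ofReal_likelihood hσ]
  rw [lintegral_const_mul' _ _ ENNReal.ofReal_ne_top, lintegral_lintegral_swap (by fun_prop)]
  have h : ∀ θ : ℝ, ∫⁻ r in {r | ‖inner ℂ s r‖ ≤ ‖inner ℂ s' r‖}, ENNReal.ofReal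
      (Real.exp (-symbolSNR σ * ‖r - Complex.exp (θ * Complex.I) • s‖ ^ 2)) =
      ∫⁻ r in {r | ‖inner ℂ s r‖ ≤ ‖inner ℂ s' r‖},
        ENNReal.ofReal (Real.exp (-symbolSNR σ * ‖r - s‖ ^ 2)) := fun θ =>
    setLIntegral_norm_sub_unit_smul (f := fun u => ENNReal.ofReal (Real.exp (-symbolSNR σ * u ^ 2)))
      (ENNReal.continuous_ofReal.comp (by fun_prop)) s hmeas _ (Complex.norm_exp_ofReal_mul_I θ)
      fun r => by simp [Complex.norm_exp_ofReal_mul_I]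
  simp_rw [h]
  rw [setLIntegral_const, Real.volume_Ioc, sub_zero, mul_comm (∫⁻ _ in _, _), ← mul_assoc,
    ← ENNReal.ofReal_mul (by positivity)]
  congr 2
  field_simp

end

/-! ### Reduction to two complex coordinates. -/

section

variable {N : ℕ}

theorem mem_orthogonal_span_pair_iff {s t w : EuclideanSpace ℂ (Fin N)} :
    w ∈ (Submodule.span ℂ {s, t})ᗮ ↔ inner ℂ s w = 0 ∧ inner ℂ t w = 0 := by
  rw [Submodule.mem_orthogonal]
  refine ⟨fun h => ⟨h s (Submodule.subset_span (by simp)), h t (Submodule.subset_span (by simp))⟩,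
    fun h u hu => ?_⟩
  obtain ⟨a, b, rfl⟩ := Submodule.mem_span_pair.1 hu
  simp [inner_add_left, inner_smul_left, h.1, h.2]

theorem norm_sq_orthonormal_pair_combination {s t w : EuclideanSpace ℂ (Fin N)} (hs : ‖s‖ = 1)
    (ht : ‖t‖ = 1) (hst : inner ℂ s t = 0) (hw : w ∈ (Submodule.span ℂ {s, t})ᗮ) (a b : ℂ) :
    ‖a • s + b • t + w‖ ^ 2 = ‖a‖ ^ 2 + ‖b‖ ^ 2 + ‖w‖ ^ 2 := by
  obtain ⟨h1, h2⟩ := mem_orthogonal_span_pair_iff.1 hw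
  rw [@norm_add_sq ℂ, @norm_add_sq ℂ, norm_smul, norm_smul, hs, ht]
  simp [inner_add_left, inner_smul_left, inner_smul_right, h1, h2, hst]

/-- The orthogonal complement of the complex span of two vectors, as a real subspace. -/
noncomputable abbrev pairComplement (s t : EuclideanSpace ℂ (Fin N)) : Submodule ℝ (EuclideanSpace ℂ (Fin N)) :=
  (Submodule.span ℂ {s, t})ᗮ.restrictScalars ℝ

/-- Coordinates on a Euclidean space adapted to an orthonormal pair. -/
noncomputable def orthonormalPairIsometry (s t : EuclideanSpace ℂ (Fin N)) (hs : ‖s‖ = 1)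
    (ht : ‖t‖ = 1) (hst : inner ℂ s t = 0) :
    WithLp 2 (WithLp 2 (ℂ × ℂ) × pairComplement s t) ≃ₗᵢ[ℝ] EuclideanSpace ℂ (Fin N) :=
  LinearIsometryEquiv.ofSurjective
    { toFun := fun q => q.fst.fst • s + q.fst.snd • t + (q.snd : EuclideanSpace ℂ (Fin N))
      map_add' := fun p q => by simp [add_smul]; abel
      map_smul' := fun c q => by simp [mul_smul]
      norm_map' := fun q => by
        rw [← sq_eq_sq₀ (norm_nonneg _) (norm_nonneg _), WithLp.prod_norm_sq_eq_of_L2,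
          WithLp.prod_norm_sq_eq_of_L2]
        exact norm_sq_orthonormal_pair_combination hs ht hst q.snd.2 _ _ }
    (fun r => by
      have hts : inner ℂ t s = 0 := inner_eq_zero_symm.1 hst
      refine ⟨WithLp.toLp 2 (WithLp.toLp 2 (inner ℂ s r, inner ℂ t r),
        ⟨r - (inner ℂ s r • s + inner ℂ t r • t), mem_orthogonal_span_pair_iff.2 ?_⟩), ?_⟩
      · simp [hst, hts, hs, ht, inner_self_eq_norm_sq_to_K]
      · simp)

theorem finrank_orthogonal_span_pair (s t : EuclideanSpace ℂ (Fin N)) (hs : ‖s‖ = 1) (ht : ‖t‖ = 1)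
    (hst : inner ℂ s t = 0) :
    Module.finrank ℝ (pairComplement s t) + 4 = 2 * N := by
  have h := (orthonormalPairIsometry s t hs ht hst).toLinearEquiv.finrank_eq
  have h1 : Module.finrank ℝ (WithLp 2 (WithLp 2 (ℂ × ℂ) × pairComplement s t)) =
      4 + Module.finrank ℝ (pairComplement s t) := by
    rw [(WithLp.linearEquiv 2 ℝ (WithLp 2 (ℂ × ℂ) × pairComplement s t)).finrank_eq,
      Module.finrank_prod, (WithLp.linearEquiv 2 ℝ (ℂ × ℂ)).finrank_eq, Module.finrank_prod]
    simp
  have h2 : Module.finrank ℝ (EuclideanSpace ℂ (Fin N)) = 2 * N := by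
    rw [finrank_real_of_complex]; simp
  omega

theorem lintegral_gaussian {V : Type*} [NormedAddCommGroup V] [InnerProductSpace ℝ V]
    [FiniteDimensional ℝ V] [MeasurableSpace V] [BorelSpace V] {T : ℝ} (hT : 0 < T) :
    ∫⁻ v : V, ENNReal.ofReal (Real.exp (-T * ‖v‖ ^ 2)) =
      ENNReal.ofReal ((Real.pi / T) ^ (Module.finrank ℝ V / 2 : ℝ)) := by
  have h := GaussianFourier.integral_rexp_neg_mul_sq_norm (V := V) hT
  rw [← h, ofReal_integral_eq_lintegral_ofReal _ (ae_of_all _ fun _ => (Real.exp_pos _).le)]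
  -- A nonintegrable function has integral 0 by convention, which contradicts the positive value
  -- found.
  by_contra hn
  rw [integral_undef hn] at h
  have := Real.rpow_pos_of_pos (div_pos Real.pi_pos hT) (Module.finrank ℝ V / 2 : ℝ)
  exact this.ne h

/-- Marginalization: the Gaussian on the complement of the plane is centred and integrates out,
taking N - 2 factors of the normalization with it. -/
theorem lintegral_orthonormal_pair (s t : EuclideanSpace ℂ (Fin N)) (hs : ‖s‖ = 1) (ht : ‖t‖ = 1)
    (hst : inner ℂ s t = 0) {T : ℝ} (hT : 0 < T) {F : ℂ × ℂ → ENNReal} (hF : Measurable F) :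
    ENNReal.ofReal ((T / Real.pi) ^ N) * ∫⁻ r : EuclideanSpace ℂ (Fin N),
        F (inner ℂ s r, inner ℂ t r) * ENNReal.ofReal (Real.exp (-T * ‖r - s‖ ^ 2)) =
      ENNReal.ofReal ((T / Real.pi) ^ 2) * ∫⁻ p : ℂ × ℂ,
        F p * ENNReal.ofReal (Real.exp (-T * (‖p.1 - 1‖ ^ 2 + ‖p.2‖ ^ 2))) := by
  obtain ⟨Φ, hΦ⟩ : ∃ Φ, Φ = orthonormalPairIsometry s t hs ht hst := ⟨_, rfl⟩
  have hrank := finrank_orthogonal_span_pair s t hs ht hst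
  have hΦq : ∀ q, Φ q = q.fst.fst • s + q.fst.snd • t + (q.snd : EuclideanSpace ℂ (Fin N)) :=
    fun _ => by rw [hΦ]; rfl
  have hΦs : Φ (WithLp.toLp 2 (WithLp.toLp 2 (1, 0), 0)) = s := by
    rw [hΦq]
    simp
  have hin1 : ∀ q, inner ℂ s (Φ q) = q.fst.fst := fun q => by
    have h := mem_orthogonal_span_pair_iff.1 q.snd.2
    rw [hΦq]
    simp [hst, hs, h.1, inner_self_eq_norm_sq_to_K]
  have hin2 : ∀ q, inner ℂ t (Φ q) = q.fst.snd := fun q => by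
    have h := mem_orthogonal_span_pair_iff.1 q.snd.2
    rw [hΦq]
    simp [inner_eq_zero_symm.1 hst, ht, h.2, inner_self_eq_norm_sq_to_K]
  have hnorm : ∀ q, ‖Φ q - s‖ ^ 2 = ‖q.fst.fst - 1‖ ^ 2 + ‖q.fst.snd‖ ^ 2 + ‖q.snd‖ ^ 2 := fun q => by
    have : Φ q - s = Φ (q - WithLp.toLp 2 (WithLp.toLp 2 (1, 0), 0)) := by rw [map_sub, hΦs]
    rw [this, LinearIsometryEquiv.norm_map, WithLp.prod_norm_sq_eq_of_L2,
      WithLp.prod_norm_sq_eq_of_L2]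
    simp
  have hmeas : Measurable fun r : EuclideanSpace ℂ (Fin N) =>
      F (inner ℂ s r, inner ℂ t r) * ENNReal.ofReal (Real.exp (-T * ‖r - s‖ ^ 2)) := by
    fun_prop
  have hmp : MeasurePreserving Φ volume volume := by
    exact LinearIsometryEquiv.measurePreserving
      (E := WithLp 2 (WithLp 2 (ℂ × ℂ) × pairComplement s t)) (F := EuclideanSpace ℂ (Fin N)) Φ
  have hint : ∫⁻ r : EuclideanSpace ℂ (Fin N),
        F (inner ℂ s r, inner ℂ t r) * ENNReal.ofReal (Real.exp (-T * ‖r - s‖ ^ 2)) =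
      (∫⁻ p : ℂ × ℂ, F p * ENNReal.ofReal (Real.exp (-T * (‖p.1 - 1‖ ^ 2 + ‖p.2‖ ^ 2)))) *
        ENNReal.ofReal ((Real.pi / T) ^ (N - 2)) := by
    rw [← hmp.lintegral_comp hmeas]
    simp_rw [hin1, hin2, hnorm]
    rw [← (WithLp.volume_preserving_toLp (WithLp 2 (ℂ × ℂ)) _).lintegral_comp (by fun_prop),
      Measure.volume_eq_prod, lintegral_prod _ (by fun_prop)]
    have h : ∀ (q : WithLp 2 (ℂ × ℂ)) (w : pairComplement s t),
        F (q.fst, q.snd) * ENNReal.ofReal (Real.exp (-T *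
          (‖q.fst - 1‖ ^ 2 + ‖q.snd‖ ^ 2 + ‖w‖ ^ 2))) =
        (F (q.fst, q.snd) * ENNReal.ofReal (Real.exp (-T * (‖q.fst - 1‖ ^ 2 + ‖q.snd‖ ^ 2)))) *
          ENNReal.ofReal (Real.exp (-T * ‖w‖ ^ 2)) := fun q w => by
      rw [mul_assoc, ← ENNReal.ofReal_mul (Real.exp_pos _).le, ← Real.exp_add, mul_add]
    -- The natural subtraction N - 2 is not truncated: `hrank` forces N ≥ 2.
    have hdim : (Module.finrank ℝ (pairComplement s t) / 2 : ℝ) = ((N - 2 : ℕ) : ℝ) := by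
      have h2 : Module.finrank ℝ (pairComplement s t) = 2 * (N - 2) := by omega
      rw [h2]; push_cast; ring
    have h' : ∀ q : WithLp 2 (ℂ × ℂ), ∫⁻ w : pairComplement s t,
        F (q.fst, q.snd) * ENNReal.ofReal (Real.exp (-T *
          (‖q.fst - 1‖ ^ 2 + ‖q.snd‖ ^ 2 + ‖w‖ ^ 2))) =
        (F (q.fst, q.snd) * ENNReal.ofReal (Real.exp (-T * (‖q.fst - 1‖ ^ 2 + ‖q.snd‖ ^ 2)))) *
          ENNReal.ofReal ((Real.pi / T) ^ (N - 2)) := fun q => by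
      rw [lintegral_congr (h q), lintegral_const_mul'' _ (by fun_prop), lintegral_gaussian hT,
        hdim, Real.rpow_natCast]
    refine (lintegral_congr h').trans ?_
    rw [lintegral_mul_const'' _ (by fun_prop),
      ← (WithLp.volume_preserving_toLp ℂ ℂ).lintegral_comp (by fun_prop)]
    rfl
  have hN : N = 2 + (N - 2) := by omega
  have hcancel : (T / Real.pi) ^ N * (Real.pi / T) ^ (N - 2) = (T / Real.pi) ^ 2 := by
    have : T / Real.pi * (Real.pi / T) = 1 := by field_simp
    conv_lhs => rw [hN, pow_add, ← hN, mul_assoc, ← mul_pow, this, one_pow, mul_one]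
  rw [hint, ← hcancel, ENNReal.ofReal_mul (by positivity)]
  ring

end

/-! ### The ratio of the two Gaussian coordinates. -/

/-- Multiplication by y has real Jacobian |y|²; this is the substitution v = yw that introduces the
ratio w. -/
theorem lintegral_eq_lintegral_comp_mul_left {y : ℂ} (hy : y ≠ 0) {h : ℂ → ENNReal}
    (hh : Measurable h) :
    ∫⁻ v, h v = ENNReal.ofReal (‖y‖ ^ 2) * ∫⁻ w, h (y * w) := by
  have hdet : LinearMap.det (LinearMap.mulLeft ℝ y) = ‖y‖ ^ 2 := by
    rw [← Complex.normSq_eq_norm_sq, ← Algebra.norm_complex_apply]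
    rfl
  have hpos : 0 < ‖y‖ ^ 2 := by positivity
  have hmap := Measure.map_linearMap_addHaar_eq_smul_addHaar (volume : Measure ℂ)
    (f := LinearMap.mulLeft ℝ y) (by rw [hdet]; exact hpos.ne')
  have h1 : ∫⁻ w, h (y * w) = ∫⁻ v, h v ∂(Measure.map (LinearMap.mulLeft ℝ y) volume) := by
    rw [lintegral_map hh (LinearMap.continuous_of_finiteDimensional _).measurable]
    rfl
  rw [h1, hmap, lintegral_smul_measure, hdet, smul_eq_mul, ← mul_assoc,
    ← ENNReal.ofReal_mul hpos.le, abs_of_pos (inv_pos.2 hpos), mul_inv_cancel₀ hpos.ne',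
    ENNReal.ofReal_one, one_mul]

theorem integral_exp_neg_mul_sq_complex {b : ℝ} (hb : 0 < b) :
    ∫ u : ℂ, Real.exp (-b * ‖u‖ ^ 2) = Real.pi / b := by
  have h := GaussianFourier.integral_rexp_neg_mul_sq_norm (V := ℂ) hb
  simpa using h

theorem integral_sq_mul_exp_neg_mul_sq_complex {b : ℝ} (hb : 0 < b) :
    ∫ u : ℂ, ‖u‖ ^ 2 * Real.exp (-b * ‖u‖ ^ 2) = Real.pi / b ^ 2 := by
  have h := Complex.integral_rpow_mul_exp_neg_mul_rpow (p := 2) (q := 2) (by norm_num)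
    (by norm_num) hb
  have e : (-(2 + 2) / 2 : ℝ) = -(2 : ℕ) := by norm_num
  have e' : ((2 + 2) / 2 : ℝ) = 1 + 1 := by norm_num
  rw [e, e', Real.Gamma_add_one one_ne_zero, Real.Gamma_one, Real.rpow_neg hb.le,
    Real.rpow_natCast] at h
  simp only [Real.rpow_two] at h
  rw [h]
  field_simp

theorem integrable_of_integral_pos {α : Type*} [MeasurableSpace α] {μ : Measure α} {f : α → ℝ}
    {c : ℝ} (h : ∫ a, f a ∂μ = c) (hc : 0 < c) : Integrable f μ := by
  by_contra hn
  rw [integral_undef hn] at h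
  exact hc.ne h

/-- The cross term 2m Re u is odd and integrates to 0, leaving the zeroth and second moments. -/
theorem integrable_gaussian_shifted_sq {b : ℝ} (hb : 0 < b) (m : ℝ) :
    Integrable (fun u : ℂ => ‖u + m‖ ^ 2 * Real.exp (-b * ‖u‖ ^ 2)) ∧
    ∫ u : ℂ, ‖u + m‖ ^ 2 * Real.exp (-b * ‖u‖ ^ 2) = Real.pi / b * (m ^ 2 + 1 / b) := by
  have hpi := Real.pi_pos
  have i0 := integrable_of_integral_pos (integral_exp_neg_mul_sq_complex hb) (by positivity)
  have i2 := integrable_of_integral_pos (integral_sq_mul_exp_neg_mul_sq_complex hb) (by positivity)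
  have i1 : Integrable (fun u : ℂ => u.re * Real.exp (-b * ‖u‖ ^ 2)) := by
    refine (i0.add i2).mono' (by fun_prop) (ae_of_all _ fun u => ?_)
    have h1 : |u.re| ≤ 1 + ‖u‖ ^ 2 := by
      nlinarith [Complex.abs_re_le_norm u, sq_nonneg (‖u‖ - 1)]
    rw [Real.norm_eq_abs, abs_mul, Real.abs_exp]
    simp only [Pi.add_apply]
    nlinarith [Real.exp_pos (-b * ‖u‖ ^ 2)]
  have z1 : ∫ u : ℂ, u.re * Real.exp (-b * ‖u‖ ^ 2) = 0 := by
    have := integral_neg_eq_self (fun u : ℂ => u.re * Real.exp (-b * ‖u‖ ^ 2)) volume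
    simp only [Complex.neg_re, norm_neg, neg_mul, integral_neg] at this
    simp only [neg_mul]
    linarith
  have hexp : ∀ u : ℂ, ‖u + m‖ ^ 2 * Real.exp (-b * ‖u‖ ^ 2) =
      ‖u‖ ^ 2 * Real.exp (-b * ‖u‖ ^ 2) + ((2 * m) * (u.re * Real.exp (-b * ‖u‖ ^ 2)) +
        m ^ 2 * Real.exp (-b * ‖u‖ ^ 2)) := fun u => by
    rw [← Complex.normSq_eq_norm_sq, ← Complex.normSq_eq_norm_sq, Complex.normSq_apply,
      Complex.normSq_apply]
    simp
    ring
  have i1' := i1.const_mul (2 * m)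
  have i0' := i0.const_mul (m ^ 2)
  simp_rw [hexp]
  refine ⟨i2.add (i1'.add i0'), ?_⟩
  have e1 := integral_add i2 (i1'.add i0')
  have e2 := integral_add i1' i0'
  simp only [Pi.add_apply] at e1
  rw [e1, e2, integral_const_mul, integral_const_mul,
    z1, integral_exp_neg_mul_sq_complex hb, integral_sq_mul_exp_neg_mul_sq_complex hb]
  field_simp
  ring

/-- The squared distance from `1`, plus a multiple of the squared norm, after completing the
square. -/
theorem norm_sub_one_sq_add (y w : ℂ) :
    ‖y - 1‖ ^ 2 + ‖y * w‖ ^ 2 =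
      (1 + ‖w‖ ^ 2) * ‖y - ((1 / (1 + ‖w‖ ^ 2) : ℝ) : ℂ)‖ ^ 2 + (1 - 1 / (1 + ‖w‖ ^ 2)) := by
  have hA : 0 < 1 + ‖w‖ ^ 2 := by positivity
  rw [norm_mul, mul_pow]
  generalize hA' : 1 + ‖w‖ ^ 2 = A at *
  have : ‖w‖ ^ 2 = A - 1 := by linarith
  rw [this]
  rw [← Complex.normSq_eq_norm_sq, ← Complex.normSq_eq_norm_sq, ← Complex.normSq_eq_norm_sq,
    Complex.normSq_apply, Complex.normSq_apply, Complex.normSq_apply]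
  simp only [Complex.sub_re, Complex.sub_im, Complex.ofReal_re, Complex.ofReal_im, Complex.one_re,
    Complex.one_im]
  field_simp
  ring

/-- The density of the ratio of the two coordinates of a complex Gaussian vector with mean `(1, 0)`,
as a function of `v = 1 / (1 + ‖w‖ ^ 2)`. -/
noncomputable def ratioDensity (T v : ℝ) : ℝ :=
  1 / Real.pi * v ^ 2 * (T * v + 1) * Real.exp (-T * (1 - v))

/-- For fixed w, completing the square makes y Gaussian about 1/(1 + |w|²); the Jacobian |y|²
contributes its second moment there. -/
theorem lintegral_ratio_fiber {T : ℝ} (hT : 0 < T) (w : ℂ) :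
    ENNReal.ofReal ((T / Real.pi) ^ 2) * ∫⁻ y : ℂ, ENNReal.ofReal
        (‖y‖ ^ 2 * Real.exp (-T * (‖y - 1‖ ^ 2 + ‖y * w‖ ^ 2))) =
      ENNReal.ofReal (ratioDensity T (1 / (1 + ‖w‖ ^ 2))) := by
  have hpi := Real.pi_pos
  set A := 1 + ‖w‖ ^ 2 with hA
  have hApos : 0 < A := by positivity
  set m : ℝ := 1 / A with hm
  have hI := integrable_gaussian_shifted_sq (b := T * A) (by positivity) m
  have h1 : ∫⁻ y : ℂ, ENNReal.ofReal
        (‖y‖ ^ 2 * Real.exp (-T * (‖y - 1‖ ^ 2 + ‖y * w‖ ^ 2))) =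
      ∫⁻ u : ℂ, ENNReal.ofReal (Real.exp (-T * (1 - m)) *
        (‖u + m‖ ^ 2 * Real.exp (-(T * A) * ‖u‖ ^ 2))) := by
    rw [← lintegral_add_right_eq_self _ (m : ℂ)]
    refine lintegral_congr fun u => ?_
    rw [norm_sub_one_sq_add, ← hA, ← hm, add_sub_cancel_right, mul_left_comm, ← Real.exp_add]
    congr 3
    ring
  rw [h1, ← ofReal_integral_eq_lintegral_ofReal (hI.1.const_mul _)
    (ae_of_all _ fun _ => by positivity), integral_const_mul, hI.2,
    ← ENNReal.ofReal_mul (by positivity)]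
  congr 1
  unfold ratioDensity
  rw [hm]
  field_simp

theorem lintegral_ratio {T : ℝ} (hT : 0 < T) {S : Set ℂ} (hS : MeasurableSet S)
    {R : Set (ℂ × ℂ)} (hR : MeasurableSet R)
    (hRS : ∀ y w : ℂ, y ≠ 0 → ((y, y * w) ∈ R ↔ w ∈ S)) :
    ENNReal.ofReal ((T / Real.pi) ^ 2) * ∫⁻ p : ℂ × ℂ, R.indicator 1 p *
        ENNReal.ofReal (Real.exp (-T * (‖p.1 - 1‖ ^ 2 + ‖p.2‖ ^ 2))) =
      ∫⁻ w in S, ENNReal.ofReal (ratioDensity T (1 / (1 + ‖w‖ ^ 2))) := by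
  have hind : Measurable (R.indicator (1 : ℂ × ℂ → ENNReal)) := measurable_one.indicator hR
  have hindS : Measurable (S.indicator (1 : ℂ → ENNReal)) := measurable_one.indicator hS
  have hne : ∀ᵐ y : ℂ, y ≠ 0 := by simp [ae_iff]
  have h1 : ∫⁻ p : ℂ × ℂ, R.indicator 1 p *
        ENNReal.ofReal (Real.exp (-T * (‖p.1 - 1‖ ^ 2 + ‖p.2‖ ^ 2))) =
      ∫⁻ y : ℂ, ∫⁻ w : ℂ, S.indicator 1 w * ENNReal.ofReal
        (‖y‖ ^ 2 * Real.exp (-T * (‖y - 1‖ ^ 2 + ‖y * w‖ ^ 2))) := by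
    rw [Measure.volume_eq_prod, lintegral_prod _ (by fun_prop)]
    refine lintegral_congr_ae (hne.mono fun y hy => ?_)
    dsimp only
    rw [lintegral_eq_lintegral_comp_mul_left hy (by fun_prop), ← lintegral_const_mul _ (by fun_prop)]
    refine lintegral_congr fun w => ?_
    rw [ENNReal.ofReal_mul (by positivity), mul_left_comm]
    congr 1
    by_cases hw : w ∈ S
    · rw [Set.indicator_of_mem hw, Set.indicator_of_mem ((hRS y w hy).2 hw)]; rfl
    · rw [Set.indicator_of_notMem hw, Set.indicator_of_notMem (mt (hRS y w hy).1 hw)]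
  rw [h1, lintegral_lintegral_swap (by fun_prop), ← lintegral_indicator hS,
    ← lintegral_const_mul' _ _ ENNReal.ofReal_ne_top]
  refine lintegral_congr fun w => ?_
  rw [lintegral_const_mul _ (by fun_prop), mul_left_comm, lintegral_ratio_fiber hT]
  by_cases hw : w ∈ S <;> simp [hw]

/-- With v = 1/(1 + ρ²) one has dv = -2ρv² dρ, and the density carries exactly the derivative (1 +
Tv) exp(Tv) of v exp(Tv). -/
theorem hasDerivAt_radial_antiderivative (T ρ : ℝ) :
    HasDerivAt (fun ρ : ℝ => -(1 / (2 * Real.pi) * (1 / (1 + ρ ^ 2) *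
      Real.exp (-T * (1 - 1 / (1 + ρ ^ 2)))))) (ρ * ratioDensity T (1 / (1 + ρ ^ 2))) ρ := by
  have hA : (1 + ρ ^ 2) ≠ 0 := by positivity
  have h1 : HasDerivAt (fun ρ : ℝ => 1 / (1 + ρ ^ 2)) (-(2 * ρ) / (1 + ρ ^ 2) ^ 2) ρ := by
    have := (((hasDerivAt_id ρ).pow 2).const_add 1).inv hA
    exact (this.congr_deriv (by simp)).congr_of_eventuallyEq
      (Filter.Eventually.of_forall fun _ => by simp)
  have h2 := (h1.mul (((h1.const_sub 1).const_mul (-T)).exp)).const_mul (-(1 / (2 * Real.pi)))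
  refine (h2.congr_deriv ?_).congr_of_eventuallyEq (Filter.Eventually.of_forall fun ρ => ?_)
  · unfold ratioDensity
    have := Real.pi_ne_zero
    field_simp
    ring
  · simp only [Pi.mul_apply]
    ring

theorem ratioDensity_nonneg {T v : ℝ} (hT : 0 < T) (hv : 0 ≤ v) : 0 ≤ ratioDensity T v := by
  have := Real.pi_pos
  unfold ratioDensity; positivity

theorem lintegral_radial {T : ℝ} (hT : 0 < T) {a : ℝ} (ha : 0 < a) :
    ∫⁻ ρ in Set.Ioi a, ENNReal.ofReal (ρ * ratioDensity T (1 / (1 + ρ ^ 2))) =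
      ENNReal.ofReal (1 / (2 * Real.pi) * (1 / (1 + a ^ 2) *
        Real.exp (-T * (1 - 1 / (1 + a ^ 2))))) := by
  have hpos : ∀ ρ ∈ Set.Ioi a, 0 ≤ ρ * ratioDensity T (1 / (1 + ρ ^ 2)) := fun ρ hρ =>
    mul_nonneg (ha.trans hρ).le (ratioDensity_nonneg hT (by positivity))
  have hv : Filter.Tendsto (fun ρ : ℝ => 1 / (1 + ρ ^ 2)) Filter.atTop (nhds 0) := by
    simp only [one_div]
    exact (Filter.tendsto_atTop_add_const_left _ _
      (Filter.tendsto_pow_atTop two_ne_zero)).inv_tendsto_atTop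
  have hlim : Filter.Tendsto (fun ρ : ℝ => -(1 / (2 * Real.pi) * (1 / (1 + ρ ^ 2) *
      Real.exp (-T * (1 - 1 / (1 + ρ ^ 2)))))) Filter.atTop (nhds 0) := by
    have := ((hv.mul ((Real.continuous_exp.tendsto _).comp
      ((hv.const_sub 1).const_mul (-T)))).const_mul (1 / (2 * Real.pi))).neg
    simpa using this
  rw [← ofReal_integral_eq_lintegral_ofReal
    (integrableOn_Ioi_deriv_of_nonneg' (fun ρ _ => hasDerivAt_radial_antiderivative T ρ) hpos hlim)
    ((ae_restrict_iff' measurableSet_Ioi).2 (ae_of_all _ hpos)),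
    integral_Ioi_of_hasDerivAt_of_nonneg' (fun ρ _ => hasDerivAt_radial_antiderivative T ρ)
    hpos hlim]
  congr 1
  ring

/-! ### Polar coordinates and the tilted great circle. -/

/-- The radius at which the ray in direction `φ` enters the exterior of the circle
`‖γ + δ w‖ = 1`. -/
noncomputable def entryRadius (γ δ φ : ℝ) : ℝ :=
  (Real.sqrt (γ ^ 2 * Real.cos φ ^ 2 + δ ^ 2) - γ * Real.cos φ) / δ

section

variable {γ δ : ℝ}

theorem abs_mul_cos_lt_sqrt (hδ : 0 < δ) (φ : ℝ) :
    |γ * Real.cos φ| < Real.sqrt (γ ^ 2 * Real.cos φ ^ 2 + δ ^ 2) := by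
  rw [← Real.sqrt_sq_eq_abs]
  apply Real.sqrt_lt_sqrt (sq_nonneg _)
  nlinarith [sq_pos_of_pos hδ]

theorem entryRadius_pos (hδ : 0 < δ) (φ : ℝ) : 0 < entryRadius γ δ φ := by
  have := (abs_lt.1 (abs_mul_cos_lt_sqrt (γ := γ) hδ φ)).2
  exact div_pos (by linarith) hδ

/-- On a ray the condition reads δρ² + 2γρ cos φ - δ ≥ 0. The roots have product -1, so exactly one
is positive, and it is the entry radius. -/
theorem one_le_norm_iff_entryRadius_le (hδ : 0 < δ) (hγδ : γ ^ 2 + δ ^ 2 = 1) {ρ : ℝ}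
    (hρ : 0 < ρ) (φ : ℝ) :
    1 ≤ ‖(γ : ℂ) + δ * Complex.polarCoord.symm (ρ, φ)‖ ↔ entryRadius γ δ φ ≤ ρ := by
  have hlt := abs_lt.1 (abs_mul_cos_lt_sqrt (γ := γ) hδ φ)
  have hsq : Real.sqrt (γ ^ 2 * Real.cos φ ^ 2 + δ ^ 2) ^ 2 = γ ^ 2 * Real.cos φ ^ 2 + δ ^ 2 :=
    Real.sq_sqrt (by positivity)
  have hnorm : ‖(γ : ℂ) + δ * Complex.polarCoord.symm (ρ, φ)‖ ^ 2 =
      1 + δ * (δ * ρ ^ 2 + 2 * γ * Real.cos φ * ρ - δ) := by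
    rw [← Complex.normSq_eq_norm_sq, Complex.normSq_apply, Complex.polarCoord_symm_apply]
    simp only [Complex.add_re, Complex.add_im, Complex.mul_re, Complex.mul_im, Complex.ofReal_re,
      Complex.ofReal_im, Complex.I_re, Complex.I_im]
    linear_combination hγδ + δ ^ 2 * ρ ^ 2 * Real.sin_sq_add_cos_sq φ
  rw [← one_le_sq_iff₀ (norm_nonneg _), hnorm, entryRadius, div_le_iff₀ hδ]
  set D := Real.sqrt (γ ^ 2 * Real.cos φ ^ 2 + δ ^ 2)
  have hfac : δ * (δ * ρ ^ 2 + 2 * γ * Real.cos φ * ρ - δ) =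
      (ρ * δ - (D - γ * Real.cos φ)) * (ρ * δ + (D + γ * Real.cos φ)) := by
    linear_combination hsq
  have hpos : 0 < ρ * δ + (D + γ * Real.cos φ) := by
    have := mul_pos hρ hδ
    linarith
  rw [hfac, le_add_iff_nonneg_right, mul_nonneg_iff_of_pos_right hpos, sub_nonneg]

/-- In stereographic terms 1/(1 + ρ²) is (1 + height)/2, so the quotient on the right is the height
of the great circle at azimuth φ. -/
theorem one_div_one_add_entryRadius_sq (hδ : 0 < δ) (φ : ℝ) :
    1 / (1 + entryRadius γ δ φ ^ 2) =
      (1 + γ * Real.cos φ / Real.sqrt (γ ^ 2 * Real.cos φ ^ 2 + δ ^ 2)) / 2 := by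
  have hlt := abs_lt.1 (abs_mul_cos_lt_sqrt (γ := γ) hδ φ)
  have hsq : Real.sqrt (γ ^ 2 * Real.cos φ ^ 2 + δ ^ 2) ^ 2 = γ ^ 2 * Real.cos φ ^ 2 + δ ^ 2 :=
    Real.sq_sqrt (by positivity)
  have h1 : 1 + entryRadius γ δ φ ^ 2 ≠ 0 := by positivity
  unfold entryRadius at *
  set D := Real.sqrt (γ ^ 2 * Real.cos φ ^ 2 + δ ^ 2)
  have hD : D ≠ 0 := by linarith
  rw [div_eq_iff h1]
  field_simp
  linear_combination -(D - γ * Real.cos φ) * hsq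

theorem continuous_entryRadius : Continuous (entryRadius γ δ) := by
  unfold entryRadius
  fun_prop

/-- The ratio integral over the exterior of a circle, in polar coordinates. -/
theorem setLIntegral_ratioDensity {T : ℝ} (hT : 0 < T) (hδ : 0 < δ) (hγδ : γ ^ 2 + δ ^ 2 = 1) :
    ∫⁻ w in {w : ℂ | 1 ≤ ‖(γ : ℂ) + δ * w‖}, ENNReal.ofReal (ratioDensity T (1 / (1 + ‖w‖ ^ 2))) =
      ∫⁻ φ in Set.Ioo (-Real.pi) Real.pi, ENNReal.ofReal (1 / (2 * Real.pi) *
        (1 / (1 + entryRadius γ δ φ ^ 2) *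
          Real.exp (-T * (1 - 1 / (1 + entryRadius γ δ φ ^ 2))))) := by
  have hS : MeasurableSet {w : ℂ | 1 ≤ ‖(γ : ℂ) + δ * w‖} :=
    (isClosed_le (by fun_prop) (by fun_prop)).measurableSet
  have hmeas : Measurable fun v : ℝ => ratioDensity T v := by unfold ratioDensity; fun_prop
  have hmeas' : Measurable fun p : ℝ × ℝ => {p : ℝ × ℝ | entryRadius γ δ p.2 ≤ p.1}.indicator
      (fun p => ENNReal.ofReal (p.1 * ratioDensity T (1 / (1 + p.1 ^ 2)))) p := by
    refine Measurable.indicator (by fun_prop) ?_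
    exact (isClosed_le (continuous_entryRadius.comp continuous_snd) continuous_fst).measurableSet
  rw [← lintegral_indicator hS, ← Complex.lintegral_comp_polarCoord_symm]
  have h1 : ∀ p ∈ polarCoord.target, ENNReal.ofReal p.1 •
      {w : ℂ | 1 ≤ ‖(γ : ℂ) + δ * w‖}.indicator
        (fun w => ENNReal.ofReal (ratioDensity T (1 / (1 + ‖w‖ ^ 2))))
        (Complex.polarCoord.symm p) =
      {p : ℝ × ℝ | entryRadius γ δ p.2 ≤ p.1}.indicator
        (fun p => ENNReal.ofReal (p.1 * ratioDensity T (1 / (1 + p.1 ^ 2)))) p := by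
    rintro ⟨ρ, φ⟩ ⟨hρ, -⟩
    have hρ' : 0 < ρ := hρ
    simp only [Set.indicator_apply, Set.mem_ofPred_eq, one_le_norm_iff_entryRadius_le hδ hγδ hρ',
      Complex.norm_polarCoord_symm, sq_abs, smul_eq_mul, mul_ite, mul_zero,
      ENNReal.ofReal_mul hρ'.le]
  rw [setLIntegral_congr_fun polarCoord.open_target.measurableSet h1, polarCoord_target,
    Measure.volume_eq_prod, ← Measure.prod_restrict, lintegral_prod_symm' _ hmeas']
  refine lintegral_congr fun φ => ?_
  rw [← lintegral_radial hT (entryRadius_pos (γ := γ) hδ φ), setLIntegral_congr (Ioi_ae_eq_Ici (a := entryRadius γ δ φ)),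
    ← lintegral_indicator measurableSet_Ici, ← lintegral_indicator measurableSet_Ioi]
  refine lintegral_congr fun ρ => ?_
  have := entryRadius_pos (γ := γ) hδ φ
  simp only [Set.indicator_apply, Set.mem_ofPred_eq, Set.mem_Ioi, Set.mem_Ici]
  by_cases h : entryRadius γ δ φ ≤ ρ
  · simp [h, this.trans_le h]
  · simp [h]

/-- The change of the azimuth when the axis of the sphere is tilted. -/
noncomputable def tiltedAngle (δ ψ : ℝ) : ℝ :=
  ψ + Real.arctan ((1 - δ) * (Real.sin ψ * Real.cos ψ) /
    (δ * Real.cos ψ ^ 2 + Real.sin ψ ^ 2))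

theorem tilt_denominator_pos (hδ : 0 < δ) (ψ : ℝ) :
    0 < δ * Real.cos ψ ^ 2 + Real.sin ψ ^ 2 := by
  by_cases h : Real.sin ψ = 0
  · have := Real.sin_sq_add_cos_sq ψ
    have h2 : Real.cos ψ ^ 2 = 1 := by rw [h] at this; linarith
    rw [h2, h]; linarith
  · positivity

/-- Both sides are the squared modulus of exp(-iψ)(δ cos ψ + i sin ψ). The great circle is (δ cos ψ,
sin ψ, γ cos ψ), so the argument of this number is azimuth minus arc angle; its real part is
positive, hence a single branch of `arctan` serves for all ψ. -/
theorem tilt_identity (hγδ : γ ^ 2 + δ ^ 2 = 1) (ψ : ℝ) :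
    (δ * Real.cos ψ ^ 2 + Real.sin ψ ^ 2) ^ 2 + ((1 - δ) * (Real.sin ψ * Real.cos ψ)) ^ 2 =
      1 - γ ^ 2 * Real.cos ψ ^ 2 := by
  have h1 : γ ^ 2 = 1 - δ ^ 2 := by linarith
  rw [Real.sin_sq, mul_pow, mul_pow, Real.sin_sq, h1]
  ring

theorem hasDerivAt_tiltedAngle (hδ : 0 < δ) (hγδ : γ ^ 2 + δ ^ 2 = 1) (ψ : ℝ) :
    HasDerivAt (tiltedAngle δ) (δ / (1 - γ ^ 2 * Real.cos ψ ^ 2)) ψ := by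
  have hd := tilt_denominator_pos hδ ψ
  have hid := tilt_identity hγδ ψ
  have hs := Real.hasDerivAt_sin ψ
  have hc := Real.hasDerivAt_cos ψ
  have hq := (((hs.mul hc).const_mul (1 - δ)).div (((hc.pow 2).const_mul δ).add (hs.pow 2))
    hd.ne').arctan
  refine ((hasDerivAt_id ψ).add hq).congr_deriv ?_
  simp only [Pi.mul_apply, Pi.add_apply, Pi.pow_apply, Pi.div_apply]
  have hpos : 0 < 1 - γ ^ 2 * Real.cos ψ ^ 2 := by
    rw [← hid]; positivity
  have h1 : 1 + ((1 - δ) * (Real.sin ψ * Real.cos ψ) /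
      (δ * Real.cos ψ ^ 2 + Real.sin ψ ^ 2)) ^ 2 =
      (1 - γ ^ 2 * Real.cos ψ ^ 2) / (δ * Real.cos ψ ^ 2 + Real.sin ψ ^ 2) ^ 2 := by
    rw [← hid, div_pow, add_div, div_self (by positivity)]
  rw [h1]
  field_simp
  have h2 : γ ^ 2 = 1 - δ ^ 2 := by linarith
  rw [mul_assoc (Real.cos ψ ^ 2 * δ + Real.sin ψ ^ 2), mul_div_cancel_left₀ _ (by
    rw [mul_comm]; exact hd.ne')]
  push_cast
  linear_combination -Real.cos ψ ^ 2 * h2 + ((1 - δ) * (δ * Real.cos ψ ^ 2 - Real.sin ψ ^ 2) -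
    (1 - δ)) * Real.sin_sq_add_cos_sq ψ

theorem cos_tiltedAngle (hδ : 0 < δ) (hγδ : γ ^ 2 + δ ^ 2 = 1) (ψ : ℝ) :
    Real.cos (tiltedAngle δ ψ) = δ * Real.cos ψ / Real.sqrt (1 - γ ^ 2 * Real.cos ψ ^ 2) := by
  have hd := tilt_denominator_pos hδ ψ
  have hid := tilt_identity hγδ ψ
  have hpos : 0 < 1 - γ ^ 2 * Real.cos ψ ^ 2 := by
    rw [← hid]; positivity
  have h1 : 1 + ((1 - δ) * (Real.sin ψ * Real.cos ψ) /
      (δ * Real.cos ψ ^ 2 + Real.sin ψ ^ 2)) ^ 2 =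
      (1 - γ ^ 2 * Real.cos ψ ^ 2) / (δ * Real.cos ψ ^ 2 + Real.sin ψ ^ 2) ^ 2 := by
    rw [← hid, div_pow, add_div, div_self (by positivity)]
  have hsp := Real.sqrt_pos.2 hpos
  rw [tiltedAngle, Real.cos_add, Real.cos_arctan, Real.sin_arctan, h1, Real.sqrt_div' _ (sq_nonneg _),
    Real.sqrt_sq hd.le]
  have hnum : Real.cos ψ * (δ * Real.cos ψ ^ 2 + Real.sin ψ ^ 2) -
      Real.sin ψ * ((1 - δ) * (Real.sin ψ * Real.cos ψ)) = δ * Real.cos ψ := by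
    linear_combination δ * Real.cos ψ * Real.sin_sq_add_cos_sq ψ
  rw [← hnum]
  generalize δ * Real.cos ψ ^ 2 + Real.sin ψ ^ 2 = d at *
  field_simp

/-- In the arc angle, the height on the great circle is simply γ cos ψ. -/
theorem mul_cos_tiltedAngle_div_sqrt (hδ : 0 < δ) (hγδ : γ ^ 2 + δ ^ 2 = 1) (ψ : ℝ) :
    γ * Real.cos (tiltedAngle δ ψ) /
      Real.sqrt (γ ^ 2 * Real.cos (tiltedAngle δ ψ) ^ 2 + δ ^ 2) = γ * Real.cos ψ := by
  have hpos : 0 < 1 - γ ^ 2 * Real.cos ψ ^ 2 := by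
    rw [← tilt_identity hγδ ψ]
    have := tilt_denominator_pos hδ ψ
    positivity
  have hsp := Real.sqrt_pos.2 hpos
  have h1 : γ ^ 2 * Real.cos (tiltedAngle δ ψ) ^ 2 + δ ^ 2 =
      δ ^ 2 / (1 - γ ^ 2 * Real.cos ψ ^ 2) := by
    rw [cos_tiltedAngle hδ hγδ, div_pow, Real.sq_sqrt hpos.le]
    field_simp
    ring
  rw [h1, Real.sqrt_div' _ hpos.le, Real.sqrt_sq hδ.le, cos_tiltedAngle hδ hγδ]
  field_simp

/-- Substitution φ = `tiltedAngle δ ψ`, which fixes ±π. The factor 1 + γ cos ψ from the height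
cancels against the one in the derivative's denominator 1 - γ² cos² ψ. -/
theorem integral_tilt {T : ℝ} (hδ : 0 < δ) (hγδ : γ ^ 2 + δ ^ 2 = 1) :
    ∫ φ in (-Real.pi)..Real.pi, 1 / (2 * Real.pi) * (1 / (1 + entryRadius γ δ φ ^ 2) *
          Real.exp (-T * (1 - 1 / (1 + entryRadius γ δ φ ^ 2)))) =
      δ / (4 * Real.pi) * ∫ ψ in (-Real.pi)..Real.pi,
        Real.exp (-(T / 2) * (1 - γ * Real.cos ψ)) / (1 - γ * Real.cos ψ) := by
  have hpos : ∀ ψ, 0 < 1 - γ ^ 2 * Real.cos ψ ^ 2 := fun ψ => by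
    rw [← tilt_identity hγδ ψ]
    have := tilt_denominator_pos hδ ψ
    positivity
  have hc : Continuous fun φ => 1 / (2 * Real.pi) * (1 / (1 + entryRadius γ δ φ ^ 2) *
          Real.exp (-T * (1 - 1 / (1 + entryRadius γ δ φ ^ 2)))) := by
    have := continuous_entryRadius (γ := γ) (δ := δ)
    have h1 : Continuous fun φ => 1 / (1 + entryRadius γ δ φ ^ 2) :=
      continuous_const.div (by fun_prop) fun φ => by positivity
    fun_prop
  have hc' : Continuous fun ψ => δ / (1 - γ ^ 2 * Real.cos ψ ^ 2) :=
    continuous_const.div (by fun_prop) fun ψ => (hpos ψ).ne'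
  have h := intervalIntegral.integral_comp_mul_deriv (a := -Real.pi) (b := Real.pi)
    (fun ψ _ => hasDerivAt_tiltedAngle hδ hγδ ψ) hc'.continuousOn hc
  have e1 : tiltedAngle δ Real.pi = Real.pi := by simp [tiltedAngle]
  have e2 : tiltedAngle δ (-Real.pi) = -Real.pi := by simp [tiltedAngle]
  rw [e1, e2] at h
  rw [← h, ← intervalIntegral.integral_const_mul]
  refine intervalIntegral.integral_congr fun ψ _ => ?_
  simp only [Function.comp_apply]
  rw [one_div_one_add_entryRadius_sq hδ, mul_cos_tiltedAngle_div_sqrt hδ hγδ]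
  have h3 : 1 - γ ^ 2 * Real.cos ψ ^ 2 = (1 - γ * Real.cos ψ) * (1 + γ * Real.cos ψ) := by ring
  have h4 := (hpos ψ).ne'
  have h5 : -T * (1 - (1 + γ * Real.cos ψ) / 2) = -(T / 2) * (1 - γ * Real.cos ψ) := by ring
  rw [h5]
  rw [h3] at h4 ⊢
  have h6 := left_ne_zero_of_mul h4
  have h7 := right_ne_zero_of_mul h4
  have := Real.pi_ne_zero
  field_simp
  ring

end

/-- The integral representation of the pairwise error probability over one angular variable. -/
theorem pairwiseErrorProb_eq_integral {N : ℕ} {s s' : EuclideanSpace ℂ (Fin N)} {σ γ δ : ℝ}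
    (hs : ‖s‖ = 1) (hs' : ‖s'‖ = 1) (hσ : 0 < σ) (hγ : γ = ‖inner ℂ s s'‖) (hγ0 : 0 < γ)
    (hδ : 0 < δ) (hγδ : γ ^ 2 + δ ^ 2 = 1) :
    pairwiseErrorProb σ s s' = δ / (4 * Real.pi) * ∫ ψ in (-Real.pi)..Real.pi,
      Real.exp (-(symbolSNR σ / 2) * (1 - γ * Real.cos ψ)) / (1 - γ * Real.cos ψ) := by
  have hT := symbolSNR_pos hσ
  have hγc : (γ : ℂ) ≠ 0 := by exact_mod_cast hγ0.ne'
  have hδc : (δ : ℂ) ≠ 0 := by exact_mod_cast hδ.ne'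
  set κ : ℂ := inner ℂ s s' with hκ
  -- The phase of the inner product. Once it is removed from s', the inner product with s is the
  -- real number γ, and t below is the second Gram–Schmidt vector.
  set e : ℂ := κ / γ with he
  have henorm : ‖e‖ = 1 := by
    rw [he, norm_div, ← hγ, Complex.norm_real, Real.norm_of_nonneg hγ0.le, div_self hγ0.ne']
  have hee : e ≠ 0 := norm_ne_zero_iff.1 (by rw [henorm]; exact one_ne_zero)
  have hκe : κ = e * γ := by rw [he]; field_simp
  set t : EuclideanSpace ℂ (Fin N) := (δ : ℂ)⁻¹ • (e⁻¹ • s' - (γ : ℂ) • s) with ht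
  have hs'eq : s' = e • ((γ : ℂ) • s + (δ : ℂ) • t) := by
    rw [ht, smul_inv_smul₀ hδc, add_sub_cancel, smul_inv_smul₀ hee]
  have hss : inner ℂ s s = (1 : ℂ) := by simp [inner_self_eq_norm_sq_to_K, hs]
  have hst : inner ℂ s t = 0 := by
    rw [ht, inner_smul_right, inner_sub_right, inner_smul_right, inner_smul_right, hss, ← hκ, hκe]
    field_simp
    ring
  have htnorm : ‖t‖ = 1 := by
    have h1 : ‖(γ : ℂ) • s + (δ : ℂ) • t‖ ^ 2 = γ ^ 2 + δ ^ 2 * ‖t‖ ^ 2 := by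
      rw [@norm_add_sq ℂ, norm_smul, norm_smul, inner_smul_left, inner_smul_right, hst, hs]
      simp [mul_pow]
    have h2 : ‖(γ : ℂ) • s + (δ : ℂ) • t‖ = 1 := by
      rw [← hs', hs'eq, norm_smul e, henorm, one_mul]
    rw [h2] at h1
    have h3 : δ ^ 2 * (‖t‖ ^ 2 - 1) = 0 := by linear_combination -h1 - hγδ
    have h4 : ‖t‖ ^ 2 = 1 := by
      have := (mul_eq_zero.1 h3).resolve_left (by positivity)
      linarith
    exact (pow_eq_one_iff_of_nonneg (norm_nonneg _) two_ne_zero).1 h4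
  have hin : ∀ r, ‖inner ℂ s' r‖ = ‖(γ : ℂ) * inner ℂ s r + δ * inner ℂ t r‖ := fun r => by
    rw [hs'eq, inner_smul_left, inner_add_left, inner_smul_left, inner_smul_left, norm_mul]
    simp [henorm]
  set R : Set (ℂ × ℂ) := {p | ‖p.1‖ ≤ ‖(γ : ℂ) * p.1 + δ * p.2‖} with hR
  have hRm : MeasurableSet R := (isClosed_le (by fun_prop) (by fun_prop)).measurableSet
  have hSm : MeasurableSet {w : ℂ | 1 ≤ ‖(γ : ℂ) + δ * w‖} :=
    (isClosed_le (by fun_prop) (by fun_prop)).measurableSet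
  have hregion : MeasurableSet {r : EuclideanSpace ℂ (Fin N) | ‖inner ℂ s r‖ ≤ ‖inner ℂ s' r‖} :=
    (isClosed_le (by fun_prop) (by fun_prop)).measurableSet
  have hRS : ∀ y w : ℂ, y ≠ 0 → ((y, y * w) ∈ R ↔ w ∈ {w : ℂ | 1 ≤ ‖(γ : ℂ) + δ * w‖}) := by
    intro y w hy
    have h1 : (γ : ℂ) * y + δ * (y * w) = y * (γ + δ * w) := by ring
    rw [hR, Set.mem_ofPred_eq, Set.mem_ofPred_eq, h1, norm_mul,
      le_mul_iff_one_le_right (norm_pos_iff.2 hy)]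
  have hind : ∫⁻ r in {r | ‖inner ℂ s r‖ ≤ ‖inner ℂ s' r‖},
        ENNReal.ofReal (Real.exp (-symbolSNR σ * ‖r - s‖ ^ 2)) =
      ∫⁻ r : EuclideanSpace ℂ (Fin N), R.indicator 1 (inner ℂ s r, inner ℂ t r) *
        ENNReal.ofReal (Real.exp (-symbolSNR σ * ‖r - s‖ ^ 2)) := by
    rw [← lintegral_indicator hregion]
    refine lintegral_congr fun r => ?_
    simp only [Set.indicator_apply, hR, Set.mem_ofPred_eq, hin]
    split_ifs <;> simp
  rw [pairwiseErrorProb_eq_toReal_lintegral hσ hs hs', hind,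
    lintegral_orthonormal_pair s t hs htnorm hst hT (measurable_one.indicator hRm),
    lintegral_ratio hT hSm hRm hRS, setLIntegral_ratioDensity hT hδ hγδ, ← integral_tilt hδ hγδ,
    intervalIntegral.integral_of_le (by linarith [Real.pi_pos]), integral_Ioc_eq_integral_Ioo,
    integral_eq_lintegral_of_nonneg_ae]
  · refine ae_of_all _ fun φ => ?_
    have := Real.pi_pos
    dsimp only [Pi.zero_apply]
    positivity
  · have h := continuous_entryRadius (γ := γ) (δ := δ)
    have h1 : Measurable fun φ => entryRadius γ δ φ := h.measurable
    refine Measurable.aestronglyMeasurable ?_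
    fun_prop

/-! ### Laplace estimates uniform in the Lorentzian width c. -/

theorem sq_mul_exp_neg_le_one {y : ℝ} (hy : 0 ≤ y) : y ^ 2 * Real.exp (-y) ≤ 1 := by
  rw [Real.exp_neg, ← div_eq_mul_inv, div_le_one (Real.exp_pos y)]
  have h := Real.add_one_le_exp (y / 2)
  have h2 : Real.exp y = Real.exp (y / 2) ^ 2 := by rw [← Real.exp_nat_mul]; congr 1; push_cast; ring
  have h3 := Real.quadratic_le_exp_of_nonneg (x := y / 2) (by linarith)
  rw [h2]
  nlinarith [sq_nonneg (y / 2 - 1), sq_nonneg (y/2)]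

theorem mul_exp_neg_le_one (y : ℝ) : y * Real.exp (-y) ≤ 1 := by
  rw [Real.exp_neg, ← div_eq_mul_inv, div_le_one (Real.exp_pos y)]
  linarith [Real.add_one_le_exp y]

/-- Half of the exponential decay pays for the polynomial factor. -/
theorem pow_mul_exp_neg_le {x p : ℝ} (hx : 0 < x) (hp : 0 ≤ p) {m : ℕ} (hm : m = 1 ∨ m = 2) :
    p ^ m * Real.exp (-2 * x * p) ≤ (1 / x) ^ m * Real.exp (-x * p) := by
  have h1 : (x * p) ^ m * Real.exp (-(x * p)) ≤ 1 := by
    rcases hm with rfl | rfl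
    · simpa using mul_exp_neg_le_one (x * p)
    · exact sq_mul_exp_neg_le_one (by positivity)
  have h2 : Real.exp (-2 * x * p) = Real.exp (-(x * p)) * Real.exp (-x * p) := by
    rw [← Real.exp_add]; congr 1; ring
  have h3 : p ^ m = (1 / x) ^ m * (x * p) ^ m := by
    rw [← mul_pow]; congr 1; field_simp
  rw [h2, h3]
  calc (1 / x) ^ m * (x * p) ^ m * (Real.exp (-(x * p)) * Real.exp (-x * p))
      = (1 / x) ^ m * ((x * p) ^ m * Real.exp (-(x * p))) * Real.exp (-x * p) := by ring
    _ ≤ (1 / x) ^ m * 1 * Real.exp (-x * p) := by gcongr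
    _ = _ := by ring

/-- Jordan's inequality |sin(ψ/2)| ≥ |ψ|/π compares the integrand with a true Gaussian. -/
theorem integral_exp_neg_mul_sin_half_sq_le {x : ℝ} (hx : 0 < x) :
    ∫ ψ in (-Real.pi)..Real.pi, Real.exp (-x * Real.sin (ψ / 2) ^ 2) ≤
      Real.pi * Real.sqrt Real.pi / Real.sqrt x := by
  have hpi := Real.pi_pos
  have hb : 0 < x / Real.pi ^ 2 := by positivity
  have h1 : ∫ ψ in (-Real.pi)..Real.pi, Real.exp (-x * Real.sin (ψ / 2) ^ 2) ≤
      ∫ ψ in (-Real.pi)..Real.pi, Real.exp (-(x / Real.pi ^ 2) * ψ ^ 2) := by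
    refine intervalIntegral.integral_mono_on (by linarith)
      (Continuous.intervalIntegrable (by fun_prop) _ _)
      (Continuous.intervalIntegrable (by fun_prop) _ _) fun ψ hψ => ?_
    have h2 : |ψ| / Real.pi ≤ |Real.sin (ψ / 2)| := by
      have := Real.mul_abs_le_abs_sin (x := ψ / 2) (by
        rw [abs_div, abs_two]; have := abs_le.2 hψ; linarith)
      refine le_trans (le_of_eq ?_) this
      rw [abs_div, abs_two]; field_simp
    have h3 : (ψ / Real.pi) ^ 2 ≤ Real.sin (ψ / 2) ^ 2 := by
      rw [sq_le_sq, abs_div, abs_of_pos hpi]; exact h2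
    apply Real.exp_le_exp.2
    have h4 := mul_le_mul_of_nonneg_left h3 hx.le
    have h5 : x * (ψ / Real.pi) ^ 2 = x / Real.pi ^ 2 * ψ ^ 2 := by field_simp
    linarith
  have h2 : ∫ ψ in (-Real.pi)..Real.pi, Real.exp (-(x / Real.pi ^ 2) * ψ ^ 2) ≤
      ∫ ψ, Real.exp (-(x / Real.pi ^ 2) * ψ ^ 2) := by
    rw [intervalIntegral.integral_of_le (by linarith)]
    exact setIntegral_le_integral (integrable_exp_neg_mul_sq hb)
      (ae_of_all _ fun _ => (Real.exp_pos _).le)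
  refine (h1.trans h2).trans (le_of_eq ?_)
  rw [integral_gaussian, div_div_eq_mul_div, Real.sqrt_div (by positivity),
    Real.sqrt_mul hpi.le, Real.sqrt_sq hpi.le, mul_comm]

/-- On |ψ| ≤ 1/√x the exponent is at least -1/2, so the integrand is at least 1/2. -/
theorem le_integral_exp_neg_mul_sin_half_sq {x : ℝ} (hx : 1 ≤ x) :
    1 / Real.sqrt x ≤
      ∫ ψ in (-Real.pi)..Real.pi, Real.exp (-2 * x * Real.sin (ψ / 2) ^ 2) := by
  have hpi := Real.pi_gt_three
  have hx0 : 0 < x := by linarith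
  have hsx : 1 ≤ Real.sqrt x := Real.one_le_sqrt.2 hx
  set a := 1 / Real.sqrt x with ha
  have ha0 : 0 < a := by positivity
  have ha1 : a ≤ 1 := by rw [ha, div_le_one (by positivity)]; exact hsx
  have hxa : x * a ^ 2 = 1 := by
    rw [ha, div_pow, Real.sq_sqrt hx0.le]; field_simp
  have hc : Continuous fun ψ : ℝ => Real.exp (-2 * x * Real.sin (ψ / 2) ^ 2) := by fun_prop
  have h1 : ∫ ψ in (-a)..a, Real.exp (-2 * x * Real.sin (ψ / 2) ^ 2) ≤
      ∫ ψ in (-Real.pi)..Real.pi, Real.exp (-2 * x * Real.sin (ψ / 2) ^ 2) :=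
    intervalIntegral.integral_mono_interval (by linarith) (by linarith) (by linarith)
      (ae_of_all _ fun _ => (Real.exp_pos _).le) (hc.intervalIntegrable _ _)
  refine le_trans ?_ h1
  have h2 : ∫ ψ in (-a)..a, (1 / 2 : ℝ) ≤
      ∫ ψ in (-a)..a, Real.exp (-2 * x * Real.sin (ψ / 2) ^ 2) := by
    refine intervalIntegral.integral_mono_on (by linarith) (by simp) (hc.intervalIntegrable _ _)
      fun ψ hψ => ?_
    have h3 : Real.sin (ψ / 2) ^ 2 ≤ (ψ / 2) ^ 2 := sq_le_sq.2 Real.abs_sin_le_abs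
    have h4 : ψ ^ 2 ≤ a ^ 2 := sq_le_sq.2 (by rw [abs_of_pos ha0]; exact abs_le.2 hψ)
    have h5 : -(1 / 2) ≤ -2 * x * Real.sin (ψ / 2) ^ 2 := by nlinarith
    have h6 := Real.add_one_le_exp (-2 * x * Real.sin (ψ / 2) ^ 2)
    linarith
  refine le_trans (le_of_eq ?_) h2
  rw [intervalIntegral.integral_const]
  simp; ring

/-- The Gaussian moments on the half circle are comparable with powers of the variance. -/
theorem integral_sin_pow_mul_exp_le {x : ℝ} (hx : 1 ≤ x) {m : ℕ} (hm : m = 1 ∨ m = 2) :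
    ∫ ψ in (-Real.pi)..Real.pi, (Real.sin (ψ / 2) ^ 2) ^ m *
        Real.exp (-2 * x * Real.sin (ψ / 2) ^ 2) ≤
      (8 / x) ^ m *
        ∫ ψ in (-Real.pi)..Real.pi, Real.exp (-2 * x * Real.sin (ψ / 2) ^ 2) := by
  have hpi := Real.pi_pos
  have hx0 : 0 < x := by linarith
  have h1 : ∫ ψ in (-Real.pi)..Real.pi, (Real.sin (ψ / 2) ^ 2) ^ m *
        Real.exp (-2 * x * Real.sin (ψ / 2) ^ 2) ≤
      ∫ ψ in (-Real.pi)..Real.pi, (1 / x) ^ m * Real.exp (-x * Real.sin (ψ / 2) ^ 2) := by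
    refine intervalIntegral.integral_mono_on (by linarith)
      (Continuous.intervalIntegrable (by fun_prop) _ _)
      (Continuous.intervalIntegrable (by fun_prop) _ _) fun ψ hψ => ?_
    exact pow_mul_exp_neg_le hx0 (sq_nonneg _) hm
  rw [intervalIntegral.integral_const_mul] at h1
  have hsp : Real.sqrt Real.pi ≤ 2 := by
    rw [Real.sqrt_le_left (by norm_num)]; linarith [Real.pi_le_four]
  -- The source of the constant 8: π ≤ 4 and √π ≤ 2.
  have h2 : Real.pi * Real.sqrt Real.pi ≤ 8 := by
    nlinarith [Real.pi_le_four, Real.sqrt_nonneg Real.pi]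
  have h8 : (8 : ℝ) ≤ 8 ^ m := by rcases hm with rfl | rfl <;> norm_num
  calc _ ≤ _ := h1
    _ ≤ (1 / x) ^ m * (Real.pi * Real.sqrt Real.pi / Real.sqrt x) := by
        gcongr; exact integral_exp_neg_mul_sin_half_sq_le hx0
    _ ≤ (1 / x) ^ m * (8 ^ m / Real.sqrt x) := by gcongr; linarith
    _ = (8 / x) ^ m * (1 / Real.sqrt x) := by
        rw [div_pow, div_pow, one_pow]; ring
    _ ≤ _ := by gcongr; exact le_integral_exp_neg_mul_sin_half_sq hx

/-- The Gaussian weight with a Lorentzian factor. -/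
noncomputable def lorentzGauss (x c u : ℝ) : ℝ := Real.exp (-2 * x * u ^ 2) / (c ^ 2 + u ^ 2)

/-- The angular integral of the weight `lorentzGauss`. -/
noncomputable def angularIntegral (x c : ℝ) : ℝ :=
  1 / 2 * ∫ ψ in (-Real.pi)..Real.pi, lorentzGauss x c (Real.sin (ψ / 2))

section

variable {x c : ℝ}

theorem continuous_lorentzGauss (hc : 0 < c) : Continuous (lorentzGauss x c) := by
  unfold lorentzGauss
  exact Continuous.div (by fun_prop) (by fun_prop) fun u => by positivity

theorem lorentzGauss_nonneg (u : ℝ) : 0 ≤ lorentzGauss x c u := by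
  unfold lorentzGauss; positivity

/-- Chebyshev's correlation inequality: a decreasing factor lowers the moments. -/
theorem integral_sin_pow_mul_lorentzGauss_le (hx : 1 ≤ x) (hc : 0 < c) {m : ℕ}
    (hm : m = 1 ∨ m = 2) :
    ∫ ψ in (-Real.pi)..Real.pi, (Real.sin (ψ / 2) ^ 2) ^ m *
        lorentzGauss x c (Real.sin (ψ / 2)) ≤
      (8 / x) ^ m * ∫ ψ in (-Real.pi)..Real.pi, lorentzGauss x c (Real.sin (ψ / 2)) := by
  have hpi := Real.pi_pos
  have hf := continuous_lorentzGauss (x := x) hc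
  set k := 8 / x with hk
  have hk0 : 0 < k := by positivity
  have key : ∫ ψ in (-Real.pi)..Real.pi, ((Real.sin (ψ / 2) ^ 2) ^ m *
        lorentzGauss x c (Real.sin (ψ / 2)) - k ^ m * lorentzGauss x c (Real.sin (ψ / 2))) ≤
      ∫ ψ in (-Real.pi)..Real.pi, 1 / (c ^ 2 + k) * ((Real.sin (ψ / 2) ^ 2) ^ m *
        Real.exp (-2 * x * Real.sin (ψ / 2) ^ 2) -
          k ^ m * Real.exp (-2 * x * Real.sin (ψ / 2) ^ 2)) := by
    refine intervalIntegral.integral_mono_on (by linarith)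
      (Continuous.intervalIntegrable (by fun_prop) _ _)
      (Continuous.intervalIntegrable (by fun_prop) _ _) fun ψ _ => ?_
    unfold lorentzGauss
    have hp : 0 ≤ Real.sin (ψ / 2) ^ 2 := sq_nonneg _
    generalize Real.sin (ψ / 2) ^ 2 = p at *
    have he := Real.exp_pos (-2 * x * p)
    -- The two factors change sign in opposite directions at p = k. Hence the Lorentzian factor may
    -- be frozen at k = 8/x, and the moment bound does not depend on c.
    have h1 : (p ^ m - k ^ m) * (1 / (c ^ 2 + p) - 1 / (c ^ 2 + k)) ≤ 0 := by
      rcases le_total p k with h | h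
      · refine mul_nonpos_of_nonpos_of_nonneg ?_ ?_
        · exact sub_nonpos.2 (by gcongr)
        · exact sub_nonneg.2 (by gcongr)
      · refine mul_nonpos_of_nonneg_of_nonpos ?_ ?_
        · exact sub_nonneg.2 (by gcongr)
        · exact sub_nonpos.2 (by gcongr)
    have h2 := mul_nonpos_of_nonneg_of_nonpos he.le h1
    have h3 : Real.exp (-2 * x * p) / (c ^ 2 + p) = Real.exp (-2 * x * p) * (1 / (c ^ 2 + p)) := by
      ring
    rw [h3]
    linarith
  rw [intervalIntegral.integral_const_mul, intervalIntegral.integral_sub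
      (Continuous.intervalIntegrable (by fun_prop) _ _)
      (Continuous.intervalIntegrable (by fun_prop) _ _), intervalIntegral.integral_sub
      (Continuous.intervalIntegrable (by fun_prop) _ _)
      (Continuous.intervalIntegrable (by fun_prop) _ _), intervalIntegral.integral_const_mul,
      intervalIntegral.integral_const_mul] at key
  have h4 := integral_sin_pow_mul_exp_le hx hm
  have h5 : 0 ≤ 1 / (c ^ 2 + k) := by positivity
  have h6 := mul_nonneg h5 (sub_nonneg.2 h4)
  linarith

theorem le_angularIntegral (hx : 1 ≤ x) (hc : 0 < c) :
    1 / (c ^ 2 + 1) * (1 / 2 * (1 / Real.sqrt x)) ≤ angularIntegral x c := by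
  have hpi := Real.pi_pos
  have hf := continuous_lorentzGauss (x := x) hc
  have h1 : ∫ ψ in (-Real.pi)..Real.pi, 1 / (c ^ 2 + 1) *
      Real.exp (-2 * x * Real.sin (ψ / 2) ^ 2) ≤
      ∫ ψ in (-Real.pi)..Real.pi, lorentzGauss x c (Real.sin (ψ / 2)) := by
    refine intervalIntegral.integral_mono_on (by linarith)
      (Continuous.intervalIntegrable (by fun_prop) _ _)
      (Continuous.intervalIntegrable (by fun_prop) _ _) fun ψ _ => ?_
    unfold lorentzGauss
    rw [div_mul_eq_mul_div, one_mul]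
    gcongr
    exact Real.sin_sq_le_one _
  rw [intervalIntegral.integral_const_mul] at h1
  have h2 := le_integral_exp_neg_mul_sin_half_sq hx
  have h3 : 1 / (c ^ 2 + 1) * (1 / Real.sqrt x) ≤
      ∫ ψ in (-Real.pi)..Real.pi, lorentzGauss x c (Real.sin (ψ / 2)) :=
    le_trans (by gcongr) h1
  unfold angularIntegral
  linarith

theorem angularIntegral_pos (hx : 1 ≤ x) (hc : 0 < c) : 0 < angularIntegral x c :=
  lt_of_lt_of_le (by positivity) (le_angularIntegral hx hc)

/-- The weight `W` approximates `1 / √(1 - u ^ 2)` to order `m` on the unit interval, and does not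
grow faster than `u ^ 2` outside. -/
structure ArcsineWeight (W : ℝ → ℝ) (m : ℕ) : Prop where
  continuous : Continuous W
  le_one : ∀ θ, 0 ≤ Real.cos θ → Real.cos θ * W (Real.sin θ) ≤ 1
  one_sub_le : ∀ θ, 0 ≤ Real.cos θ → 1 - Real.cos θ * W (Real.sin θ) ≤ (Real.sin θ ^ 2) ^ m
  nonneg : ∀ u, 0 ≤ W u
  le_sq : ∀ u, 1 ≤ |u| → W u ≤ 2 * u ^ 2
  le_quadratic : ∀ u, W u ≤ 1 + u ^ 2

theorem arcsineWeight_one : ArcsineWeight (fun _ => 1) 1 where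
  continuous := continuous_const
  le_one θ _ := by simpa using Real.cos_le_one θ
  one_sub_le θ h := by
    rw [Real.sin_sq]; nlinarith [Real.cos_le_one θ]
  nonneg _ := zero_le_one
  le_sq u hu := by
    have := (one_le_sq_iff_one_le_abs u).2 hu; linarith
  le_quadratic u := by nlinarith [sq_nonneg u]

/-- These are the first two Taylor terms of 1/√(1 - u²). With k = cos θ the defect is (1 - k)²(k +
2)/2, against (1 - k)²(1 + k)² on the right. -/
theorem arcsineWeight_two : ArcsineWeight (fun u => 1 + u ^ 2 / 2) 2 where
  continuous := by fun_prop
  le_one θ h := by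
    rw [Real.sin_sq]
    nlinarith [Real.cos_le_one θ, sq_nonneg (Real.cos θ - 1), mul_nonneg h (sq_nonneg (Real.cos θ - 1))]
  one_sub_le θ h := by
    rw [Real.sin_sq]
    have h1 := Real.cos_le_one θ
    generalize Real.cos θ = k at *
    have h2 : 0 ≤ k * (1 - k) := mul_nonneg h (by linarith)
    nlinarith [mul_nonneg h2 h, mul_nonneg (mul_nonneg h2 h) h, mul_nonneg h2 (sub_nonneg.2 h1)]
  nonneg u := by positivity
  le_sq u hu := by
    have := (one_le_sq_iff_one_le_abs u).2 hu; linarith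
  le_quadratic u := by nlinarith [sq_nonneg u]

theorem integral_lorentzGauss_mul_eq (hc : 0 < c) {W : ℝ → ℝ} (hW : Continuous W) :
    ∫ u in (-1 : ℝ)..1, lorentzGauss x c u * W u =
      1 / 2 * ∫ ψ in (-Real.pi)..Real.pi, lorentzGauss x c (Real.sin (ψ / 2)) *
        (Real.cos (ψ / 2) * W (Real.sin (ψ / 2))) := by
  have hf := continuous_lorentzGauss (x := x) hc
  have hd : ∀ ψ : ℝ, HasDerivAt (fun ψ => Real.sin (ψ / 2)) (Real.cos (ψ / 2) * (1 / 2)) ψ :=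
    fun ψ => ((hasDerivAt_id ψ).div_const 2).sin
  have h := intervalIntegral.integral_comp_mul_deriv (a := -Real.pi) (b := Real.pi)
    (fun ψ _ => hd ψ) (by fun_prop) (hf.mul hW)
  have e1 : Real.sin (-Real.pi / 2) = -1 := by rw [neg_div, Real.sin_neg, Real.sin_pi_div_two]
  simp only [Function.comp_apply, Pi.mul_apply, Real.sin_pi_div_two, e1] at h
  rw [← h, ← intervalIntegral.integral_const_mul]
  refine intervalIntegral.integral_congr fun ψ _ => ?_
  ring

theorem integrable_lorentzGauss_mul (hx : 0 < x) (hc : 0 < c) {W : ℝ → ℝ} {m : ℕ}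
    (hW : ArcsineWeight W m) : Integrable fun u => lorentzGauss x c u * W u := by
  have hf := continuous_lorentzGauss (x := x) hc
  have h1 : Integrable fun u : ℝ => Real.exp (-(2 * x) * u ^ 2) :=
    integrable_exp_neg_mul_sq (by positivity)
  refine (h1.const_mul (1 / c ^ 2 + 1)).mono' (hf.mul hW.continuous).aestronglyMeasurable
    (ae_of_all _ fun u => ?_)
  rw [Real.norm_of_nonneg (mul_nonneg (lorentzGauss_nonneg u) (hW.nonneg u))]
  have h2 : W u / (c ^ 2 + u ^ 2) ≤ 1 / c ^ 2 + 1 := by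
    rw [div_le_iff₀ (by positivity)]
    have h3 : (1 / c ^ 2 + 1) * (c ^ 2 + u ^ 2) = 1 + u ^ 2 + (c ^ 2 + u ^ 2 / c ^ 2) := by
      field_simp
      ring
    rw [h3]
    have : 0 ≤ c ^ 2 + u ^ 2 / c ^ 2 := by positivity
    linarith [hW.le_quadratic u]
  have h4 : lorentzGauss x c u * W u = W u / (c ^ 2 + u ^ 2) * Real.exp (-(2 * x) * u ^ 2) := by
    unfold lorentzGauss; rw [← neg_mul]; ring
  rw [h4]
  gcongr

/-- On the unit interval u = sin(ψ/2) turns the defect of W into a moment of sin²(ψ/2), bounded by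
the correlation inequality; the tail outside is exponentially small. -/
theorem abs_angularIntegral_sub_integral_le (hx : 1 ≤ x) (hc : 0 < c) {W : ℝ → ℝ} {m : ℕ}
    (hm : m = 1 ∨ m = 2) (hW : ArcsineWeight W m) :
    |angularIntegral x c - ∫ u, lorentzGauss x c u * W u| ≤
      72 / x ^ m * angularIntegral x c := by
  have hpi := Real.pi_pos
  have hx0 : 0 < x := by linarith
  have hf := continuous_lorentzGauss (x := x) hc
  have hWc := hW.continuous
  have hint := integrable_lorentzGauss_mul hx0 hc hW
  have hcos : ∀ ψ ∈ Set.Icc (-Real.pi) Real.pi, 0 ≤ Real.cos (ψ / 2) := fun ψ hψ =>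
    Real.cos_nonneg_of_mem_Icc ⟨by linarith [hψ.1], by linarith [hψ.2]⟩
  -- the interior part
  have hin0 : ∫ u in (-1 : ℝ)..1, lorentzGauss x c u * W u ≤ angularIntegral x c := by
    rw [integral_lorentzGauss_mul_eq hc hWc, angularIntegral]
    gcongr
    refine intervalIntegral.integral_mono_on (by linarith)
      (Continuous.intervalIntegrable (by fun_prop) _ _)
      (Continuous.intervalIntegrable (by fun_prop) _ _) fun ψ hψ => ?_
    exact mul_le_of_le_one_right (lorentzGauss_nonneg _) (hW.le_one _ (hcos ψ hψ))
  have hin1 : angularIntegral x c - ∫ u in (-1 : ℝ)..1, lorentzGauss x c u * W u ≤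
      (8 / x) ^ m * angularIntegral x c := by
    have h1 : ∫ ψ in (-Real.pi)..Real.pi, (lorentzGauss x c (Real.sin (ψ / 2)) -
        lorentzGauss x c (Real.sin (ψ / 2)) * (Real.cos (ψ / 2) * W (Real.sin (ψ / 2)))) ≤
        ∫ ψ in (-Real.pi)..Real.pi, (Real.sin (ψ / 2) ^ 2) ^ m *
          lorentzGauss x c (Real.sin (ψ / 2)) := by
      refine intervalIntegral.integral_mono_on (by linarith)
        (Continuous.intervalIntegrable (by fun_prop) _ _)
        (Continuous.intervalIntegrable (by fun_prop) _ _) fun ψ hψ => ?_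
      have := mul_le_mul_of_nonneg_left (hW.one_sub_le _ (hcos ψ hψ))
        (lorentzGauss_nonneg (x := x) (c := c) (Real.sin (ψ / 2)))
      linarith
    rw [intervalIntegral.integral_sub (Continuous.intervalIntegrable (by fun_prop) _ _)
      (Continuous.intervalIntegrable (by fun_prop) _ _)] at h1
    have h2 := integral_sin_pow_mul_lorentzGauss_le hx hc hm
    rw [integral_lorentzGauss_mul_eq hc hWc, angularIntegral]
    linarith
  -- the tail
  have hsplit := integral_add_compl (measurableSet_Ioc (a := (-1 : ℝ)) (b := 1)) hint
  rw [← intervalIntegral.integral_of_le (by norm_num)] at hsplit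
  have htail0 : 0 ≤ ∫ u in (Set.Ioc (-1 : ℝ) 1)ᶜ, lorentzGauss x c u * W u :=
    integral_nonneg fun u => mul_nonneg (lorentzGauss_nonneg u) (hW.nonneg u)
  -- For |u| ≥ 1 the Lorentzian factor is at most 1/(c² + 1), the factor appearing in
  -- `le_angularIntegral`, so c cancels.
  have htail1 : ∫ u in (Set.Ioc (-1 : ℝ) 1)ᶜ, lorentzGauss x c u * W u ≤
      8 / x ^ m * angularIntegral x c := by
    have hg : Integrable fun u : ℝ => Real.exp (-x * u ^ 2) := integrable_exp_neg_mul_sq hx0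
    have h1 : ∫ u in (Set.Ioc (-1 : ℝ) 1)ᶜ, lorentzGauss x c u * W u ≤
        ∫ u in (Set.Ioc (-1 : ℝ) 1)ᶜ, 2 / ((c ^ 2 + 1) * x ^ m) * Real.exp (-x * u ^ 2) := by
      refine setIntegral_mono_on hint.integrableOn (hg.const_mul _).integrableOn
        measurableSet_Ioc.compl fun u hu => ?_
      have hu1 : 1 ≤ |u| := by
        by_contra hlt
        have := abs_lt.1 (not_le.1 hlt)
        exact hu ⟨this.1, this.2.le⟩
      have hu2 := (one_le_sq_iff_one_le_abs u).2 hu1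
      have h2 := pow_mul_exp_neg_le hx0 (sq_nonneg u) hm
      have h3 : W u ≤ 2 * (u ^ 2) ^ m := by
        refine (hW.le_sq u hu1).trans ?_
        gcongr
        exact le_self_pow₀ hu2 (by rcases hm with rfl | rfl <;> norm_num)
      calc lorentzGauss x c u * W u
          ≤ Real.exp (-2 * x * u ^ 2) / (c ^ 2 + 1) * (2 * (u ^ 2) ^ m) := by
            have := hW.nonneg u
            unfold lorentzGauss
            gcongr
        _ = 2 / (c ^ 2 + 1) * ((u ^ 2) ^ m * Real.exp (-2 * x * u ^ 2)) := by ring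
        _ ≤ 2 / (c ^ 2 + 1) * ((1 / x) ^ m * Real.exp (-x * u ^ 2)) := by gcongr
        _ = _ := by rw [one_div, inv_pow]; field_simp
    have h2 : ∫ u in (Set.Ioc (-1 : ℝ) 1)ᶜ, 2 / ((c ^ 2 + 1) * x ^ m) * Real.exp (-x * u ^ 2) ≤
        2 / ((c ^ 2 + 1) * x ^ m) * (2 / Real.sqrt x) := by
      rw [integral_const_mul]
      gcongr
      refine (setIntegral_le_integral hg (ae_of_all _ fun _ => (Real.exp_pos _).le)).trans ?_
      rw [integral_gaussian, Real.sqrt_div hpi.le]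
      gcongr
      rw [Real.sqrt_le_left (by norm_num)]; linarith [Real.pi_le_four]
    refine (h1.trans h2).trans ?_
    have h3 := le_angularIntegral hx hc
    calc 2 / ((c ^ 2 + 1) * x ^ m) * (2 / Real.sqrt x)
        = 8 / x ^ m * (1 / (c ^ 2 + 1) * (1 / 2 * (1 / Real.sqrt x))) := by field_simp; norm_num
      _ ≤ _ := by gcongr
  -- Since 8 ^ m ≤ 64, interior and tail together give 72 = 64 + 8.
  have h64 : (8 / x) ^ m * angularIntegral x c ≤ 64 / x ^ m * angularIntegral x c := by
    have := (angularIntegral_pos hx hc).le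
    rw [div_pow]
    gcongr
    rcases hm with rfl | rfl <;> norm_num
  have h72 : 72 / x ^ m * angularIntegral x c =
      64 / x ^ m * angularIntegral x c + 8 / x ^ m * angularIntegral x c := by ring
  have h0 : 0 ≤ 64 / x ^ m * angularIntegral x c := by
    have := (angularIntegral_pos hx hc).le
    positivity
  have h0' : 0 ≤ 8 / x ^ m * angularIntegral x c := by
    have := (angularIntegral_pos hx hc).le
    positivity
  rw [abs_le]
  constructor <;> linarith

end

/-! ### Closed forms of the integrals over the line. -/

theorem lintegral_Ioi_mul_exp {p a : ℝ} (hp : 0 < p) (ha : 0 < a) :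
    ∫⁻ y in Set.Ioi (Real.sqrt p), ENNReal.ofReal (2 * y * Real.exp (-a * y ^ 2)) =
      ENNReal.ofReal (Real.exp (-a * p) / a) := by
  have hd : ∀ y : ℝ, HasDerivAt (fun y => -(Real.exp (-a * y ^ 2) / a))
      (2 * y * Real.exp (-a * y ^ 2)) y := fun y => by
    refine (((((hasDerivAt_pow 2 y).const_mul (-a)).exp).div_const a).neg).congr_deriv ?_
    field_simp
    push_cast
    ring
  have hlim : Filter.Tendsto (fun y : ℝ => -(Real.exp (-a * y ^ 2) / a)) Filter.atTop (nhds 0) := by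
    have h1 : Filter.Tendsto (fun y : ℝ => -a * y ^ 2) Filter.atTop Filter.atBot :=
      (Filter.tendsto_pow_atTop two_ne_zero).const_mul_atTop_of_neg (by linarith)
    simpa using ((Real.tendsto_exp_atBot.comp h1).div_const a).neg
  have hpos : ∀ y ∈ Set.Ioi (Real.sqrt p), 0 ≤ 2 * y * Real.exp (-a * y ^ 2) := fun y hy => by
    have : 0 < y := (Real.sqrt_pos.2 hp).trans hy
    positivity
  rw [← ofReal_integral_eq_lintegral_ofReal
    (integrableOn_Ioi_deriv_of_nonneg' (fun y _ => hd y) hpos hlim)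
    ((ae_restrict_iff' measurableSet_Ioi).2 (ae_of_all _ hpos)),
    integral_Ioi_of_hasDerivAt_of_nonneg' (fun y _ => hd y) hpos hlim, Real.sq_sqrt hp.le]
  congr 1
  ring

theorem integrable_exp_neg_sq : Integrable fun t : ℝ => Real.exp (-t ^ 2) := by
  simpa using integrable_exp_neg_mul_sq (b := 1) one_pos

/-- After multiplication by exp(-2xc²) the integrand is exp(-2xa)/a with a = c² + u², which is the
integral of 2y exp(-ay²) over y > √(2x). Swapping the integrals leaves a Gaussian in u, then an erfc
tail in y. -/
theorem integral_lorentzGauss {x c : ℝ} (hx : 0 < x) (hc : 0 < c) :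
    ∫ u, lorentzGauss x c u =
      Real.pi / c * Real.exp (2 * x * c ^ 2) * erfc (c * Real.sqrt (2 * x)) := by
  have hpi := Real.pi_pos
  have hp : 0 < 2 * x := by positivity
  have hf := continuous_lorentzGauss (x := x) hc
  have hsp : 0 < Real.sqrt (2 * x) := Real.sqrt_pos.2 hp
  have e1 : ∫⁻ u, ENNReal.ofReal (Real.exp (-(2 * x * c ^ 2)) * lorentzGauss x c u) =
      ∫⁻ y in Set.Ioi (Real.sqrt (2 * x)), ENNReal.ofReal
        (2 * Real.sqrt Real.pi * Real.exp (-(c * y) ^ 2)) := by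
    have h1 : ∀ u, ENNReal.ofReal (Real.exp (-(2 * x * c ^ 2)) * lorentzGauss x c u) =
        ∫⁻ y in Set.Ioi (Real.sqrt (2 * x)),
          ENNReal.ofReal (2 * y * Real.exp (-(c ^ 2 + u ^ 2) * y ^ 2)) := fun u => by
      rw [lintegral_Ioi_mul_exp hp (by positivity), lorentzGauss, ← mul_div_assoc, ← Real.exp_add]
      congr 3
      ring
    simp_rw [h1]
    rw [lintegral_lintegral_swap (by fun_prop)]
    refine setLIntegral_congr_fun measurableSet_Ioi fun y hy => ?_
    have hy0 : 0 < y := hsp.trans hy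
    have h2 : ∀ u : ℝ, 2 * y * Real.exp (-(c ^ 2 + u ^ 2) * y ^ 2) =
        (2 * y * Real.exp (-(c * y) ^ 2)) * Real.exp (-(y ^ 2) * u ^ 2) := fun u => by
      rw [mul_assoc (2 * y), ← Real.exp_add]
      congr 2
      ring
    simp_rw [h2]
    rw [← ofReal_integral_eq_lintegral_ofReal
      ((integrable_exp_neg_mul_sq (by positivity)).const_mul _) (ae_of_all _ fun u => by positivity),
      integral_const_mul, integral_gaussian, Real.sqrt_div hpi.le, Real.sqrt_sq hy0.le]
    congr 1
    field_simp
  have h3 : IntegrableOn (fun y : ℝ => Real.exp (-(c * y) ^ 2)) (Set.Ioi (Real.sqrt (2 * x))) :=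
    (integrable_exp_neg_sq.comp_mul_left' hc.ne').integrableOn
  have e2 : ∫ u, Real.exp (-(2 * x * c ^ 2)) * lorentzGauss x c u =
      ∫ y in Set.Ioi (Real.sqrt (2 * x)), 2 * Real.sqrt Real.pi * Real.exp (-(c * y) ^ 2) := by
    rw [integral_eq_lintegral_of_nonneg_ae
      (ae_of_all _ fun u => mul_nonneg (Real.exp_pos _).le (lorentzGauss_nonneg u))
      (hf.const_mul _).aestronglyMeasurable, e1, integral_eq_lintegral_of_nonneg_ae
      (ae_of_all _ fun u => by positivity) (by fun_prop)]
  rw [integral_const_mul, integral_const_mul,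
    integral_comp_mul_left_Ioi (fun t => Real.exp (-t ^ 2)) _ hc] at e2
  have h4 : Real.exp (2 * x * c ^ 2) * Real.exp (-(2 * x * c ^ 2)) = 1 := by
    rw [← Real.exp_add, add_neg_cancel, Real.exp_zero]
  calc ∫ u, lorentzGauss x c u
      = Real.exp (2 * x * c ^ 2) * (Real.exp (-(2 * x * c ^ 2)) * ∫ u, lorentzGauss x c u) := by
        rw [← mul_assoc, h4, one_mul]
    _ = _ := by
        rw [e2, erfc, smul_eq_mul]
        have hs : Real.sqrt Real.pi ^ 2 = Real.pi := Real.sq_sqrt hpi.le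
        have hs0 : Real.sqrt Real.pi ≠ 0 := (Real.sqrt_pos.2 hpi).ne'
        generalize ∫ t in Set.Ioi (c * Real.sqrt (2 * x)), Real.exp (-t ^ 2) = J
        rw [← hs]
        field_simp
        simp [Real.sqrt_sq]

/-- Writing u² = (c² + u²) - c² cancels the Lorentzian denominator in one term. -/
theorem integral_lorentzGauss_mul_weight {x c : ℝ} (hx : 0 < x) (hc : 0 < c) :
    ∫ u, lorentzGauss x c u * (1 + u ^ 2 / 2) =
      (1 - c ^ 2 / 2) * (∫ u, lorentzGauss x c u) +
        1 / 2 * (Real.sqrt Real.pi / Real.sqrt (2 * x)) := by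
  have h1 : ∀ u, lorentzGauss x c u * (1 + u ^ 2 / 2) =
      (1 - c ^ 2 / 2) * lorentzGauss x c u + 1 / 2 * Real.exp (-(2 * x) * u ^ 2) := fun u => by
    have : c ^ 2 + u ^ 2 ≠ 0 := by positivity
    unfold lorentzGauss
    rw [← neg_mul]
    field_simp
    ring
  have h2 : Integrable (lorentzGauss x c) := by
    simpa using integrable_lorentzGauss_mul hx hc arcsineWeight_one
  simp_rw [h1]
  rw [integral_add (h2.const_mul _) ((integrable_exp_neg_mul_sq (by positivity)).const_mul _),
    integral_const_mul, integral_const_mul, integral_gaussian, Real.sqrt_div Real.pi_pos.le]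

/-! ### Bounds for the complementary error function -/

/-- A function decreasing to 0 is nonnegative. Every erfc bound below applies this to a difference
whose derivative is a Gaussian times a rational function of evident sign. -/
theorem nonneg_of_hasDerivAt_nonpos_of_tendsto_zero {H H' : ℝ → ℝ} {z : ℝ}
    (hd : ∀ t, z ≤ t → HasDerivAt H (H' t) t) (hs : ∀ t, z ≤ t → H' t ≤ 0)
    (hlim : Filter.Tendsto H Filter.atTop (nhds 0)) : 0 ≤ H z := by
  have hanti : AntitoneOn H (Set.Ici z) := by
    refine antitoneOn_of_deriv_nonpos (convex_Ici z)
      (fun t ht => (hd t ht).continuousAt.continuousWithinAt)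
      (fun t ht => ?_) (fun t ht => ?_)
    · rw [interior_Ici] at ht
      exact (hd t (le_of_lt ht)).differentiableAt.differentiableWithinAt
    · rw [interior_Ici] at ht
      rw [(hd t (le_of_lt ht)).deriv]
      exact hs t (le_of_lt ht)
  refine le_of_tendsto hlim ?_
  filter_upwards [Filter.eventually_ge_atTop z] with t ht
  exact hanti Set.self_mem_Ici ht ht

/-- The complementary error function scaled by `√π`. -/
noncomputable def scaledErfc (z : ℝ) : ℝ := 2 * ∫ t in Set.Ioi z, Real.exp (-t ^ 2)

theorem erfc_eq_scaledErfc_div (z : ℝ) : erfc z = scaledErfc z / Real.sqrt Real.pi := by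
  unfold erfc scaledErfc; ring

theorem scaledErfc_eq (z : ℝ) :
    scaledErfc z = scaledErfc 0 - 2 * ∫ t in (0 : ℝ)..z, Real.exp (-t ^ 2) := by
  have h := intervalIntegral.integral_Ioi_sub_Ioi' (a := 0) (b := z)
    (integrable_exp_neg_sq.integrableOn) (integrable_exp_neg_sq.integrableOn)
  unfold scaledErfc
  rw [← h]
  ring

theorem hasDerivAt_scaledErfc (z : ℝ) : HasDerivAt scaledErfc (-2 * Real.exp (-z ^ 2)) z := by
  rw [funext scaledErfc_eq]
  have hc : Continuous fun t : ℝ => Real.exp (-t ^ 2) := by fun_prop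
  have := ((hc.integral_hasStrictDerivAt 0 z).hasDerivAt.const_mul 2).const_sub (scaledErfc 0)
  exact this.congr_deriv (by ring)

theorem tendsto_scaledErfc : Filter.Tendsto scaledErfc Filter.atTop (nhds 0) := by
  rw [funext scaledErfc_eq]
  have h := (intervalIntegral_tendsto_integral_Ioi 0 (integrable_exp_neg_sq.integrableOn)
    Filter.tendsto_id).const_mul 2 |>.const_sub (scaledErfc 0)
  refine h.congr' (Filter.Eventually.of_forall fun _ => rfl) |>.trans ?_
  rw [scaledErfc, sub_self]

theorem scaledErfc_pos (z : ℝ) : 0 < scaledErfc z := by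
  unfold scaledErfc
  refine mul_pos two_pos ?_
  rw [setIntegral_pos_iff_support_of_nonneg_ae (ae_of_all _ fun _ => (Real.exp_pos _).le)
    integrable_exp_neg_sq.integrableOn]
  have : Function.support (fun t : ℝ => Real.exp (-t ^ 2)) = Set.univ := by
    ext t; simp [(Real.exp_pos _).ne']
  rw [this, Set.univ_inter, Real.volume_Ioi]
  exact ENNReal.coe_lt_top

theorem hasDerivAt_exp_neg_sq (t : ℝ) :
    HasDerivAt (fun t : ℝ => Real.exp (-t ^ 2)) (-2 * t * Real.exp (-t ^ 2)) t := by
  refine ((hasDerivAt_pow 2 t).fun_neg.exp).congr_deriv ?_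
  push_cast; ring

theorem tendsto_exp_neg_sq : Filter.Tendsto (fun t : ℝ => Real.exp (-t ^ 2)) Filter.atTop (nhds 0) :=
  Real.tendsto_exp_atBot.comp
    (Filter.tendsto_neg_atTop_atBot.comp (Filter.tendsto_pow_atTop two_ne_zero))

theorem tendsto_inv_pow_atTop {n : ℕ} (hn : n ≠ 0) :
    Filter.Tendsto (fun t : ℝ => (t ^ n)⁻¹) Filter.atTop (nhds 0) :=
  (Filter.tendsto_pow_atTop hn).inv_tendsto_atTop

theorem hasDerivAt_inv_pow {t : ℝ} (ht : 0 < t) (n : ℕ) :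
    HasDerivAt (fun t : ℝ => (t ^ n)⁻¹) (-(n : ℝ) * (t ^ (n + 1))⁻¹) t := by
  have h := (hasDerivAt_pow n t).fun_inv (pow_ne_zero n ht.ne')
  refine h.congr_deriv ?_
  rcases n with _ | n
  · simp
  · simp only [Nat.add_sub_cancel]
    field_simp
    ring

section

variable {z : ℝ}

theorem exp_neg_sq_le_one_add_mul_scaledErfc (hz : 0 ≤ z) :
    Real.exp (-z ^ 2) ≤ (1 + z) * scaledErfc z := by
  have h := nonneg_of_hasDerivAt_nonpos_of_tendsto_zero (z := z)
    (H := fun t => scaledErfc t - Real.exp (-t ^ 2) * (1 + t)⁻¹)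
    (H' := fun t => -Real.exp (-t ^ 2) * (2 * t + 1) / (1 + t) ^ 2) (fun t ht => ?_) (fun t ht => ?_)
    ?_
  · have hz1 : 0 < 1 + z := by linarith
    have h2 : Real.exp (-z ^ 2) * (1 + z)⁻¹ ≤ scaledErfc z := by linarith
    rwa [mul_inv_le_iff₀ hz1, mul_comm] at h2
  · have ht1 : 1 + t ≠ 0 := by linarith
    refine ((hasDerivAt_scaledErfc t).fun_sub ((hasDerivAt_exp_neg_sq t).fun_mul
      (((hasDerivAt_id t).const_add 1).fun_inv ht1))).congr_deriv ?_
    simp only [id]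
    field_simp
    ring
  · have : 0 ≤ t := hz.trans ht
    rw [neg_mul, neg_div, neg_nonpos]
    positivity
  · have h1 : Filter.Tendsto (fun t : ℝ => (1 + t)⁻¹) Filter.atTop (nhds 0) :=
      (Filter.tendsto_atTop_add_const_left _ 1 Filter.tendsto_id).inv_tendsto_atTop
    simpa using tendsto_scaledErfc.sub (tendsto_exp_neg_sq.mul h1)

theorem mul_exp_neg_sq_le_one_add_sq_mul_scaledErfc (hz : 0 < z) :
    z * Real.exp (-z ^ 2) ≤ (1 + z ^ 2) * scaledErfc z := by
  have h := nonneg_of_hasDerivAt_nonpos_of_tendsto_zero (z := z)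
    (H := fun t => scaledErfc t - Real.exp (-t ^ 2) * (t * (1 + t ^ 2)⁻¹))
    (H' := fun t => -Real.exp (-t ^ 2) * (t ^ 2 + 3) / (1 + t ^ 2) ^ 2) (fun t ht => ?_)
    (fun t ht => ?_) ?_
  · have hz1 : 0 < 1 + z ^ 2 := by positivity
    have h2 : (z * Real.exp (-z ^ 2)) * (1 + z ^ 2)⁻¹ ≤ scaledErfc z := by
      linarith
    rwa [mul_inv_le_iff₀ hz1, mul_comm (scaledErfc z)] at h2
  · have ht1 : 1 + t ^ 2 ≠ 0 := by positivity
    refine ((hasDerivAt_scaledErfc t).fun_sub ((hasDerivAt_exp_neg_sq t).fun_mul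
      ((hasDerivAt_id t).fun_mul (((hasDerivAt_pow 2 t).const_add 1).fun_inv ht1)))).congr_deriv ?_
    simp only [id]
    field_simp
    ring
  · rw [neg_mul, neg_div, neg_nonpos]
    positivity
  · have h1 : Filter.Tendsto (fun t : ℝ => t * (1 + t ^ 2)⁻¹) Filter.atTop (nhds 0) := by
      refine squeeze_zero' (g := fun t : ℝ => t⁻¹) ?_ ?_ tendsto_inv_atTop_zero
      · filter_upwards [Filter.eventually_ge_atTop 0] with t ht
        positivity
      · filter_upwards [Filter.eventually_gt_atTop 0] with t ht
        rw [mul_inv_le_iff₀ (by positivity), ← div_eq_inv_mul, le_div_iff₀ ht]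
        nlinarith
    simpa using tendsto_scaledErfc.sub (tendsto_exp_neg_sq.mul h1)

theorem mul_scaledErfc_le (hz : 0 < z) : z * scaledErfc z ≤ Real.exp (-z ^ 2) := by
  have h := nonneg_of_hasDerivAt_nonpos_of_tendsto_zero (z := z)
    (H := fun t => Real.exp (-t ^ 2) * (t ^ 1)⁻¹ - scaledErfc t)
    (H' := fun t => -Real.exp (-t ^ 2) * (t ^ 2)⁻¹) (fun t ht => ?_) (fun t ht => ?_) ?_
  · have h2 : scaledErfc z ≤ Real.exp (-z ^ 2) * z⁻¹ := by simpa using h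
    rw [← div_eq_mul_inv, le_div_iff₀ hz] at h2
    linarith
  · have ht0 : 0 < t := hz.trans_le ht
    refine (((hasDerivAt_exp_neg_sq t).fun_mul (hasDerivAt_inv_pow ht0 1)).fun_sub
      (hasDerivAt_scaledErfc t)).congr_deriv ?_
    field_simp
    push_cast
    ring
  · rw [neg_mul, neg_nonpos]; positivity
  · simpa using (tendsto_exp_neg_sq.mul (tendsto_inv_pow_atTop one_ne_zero)).sub tendsto_scaledErfc

theorem exp_neg_sq_mul_le_scaledErfc (hz : 0 < z) :
    Real.exp (-z ^ 2) * (2 * z ^ 2 - 1) ≤ 2 * z ^ 3 * scaledErfc z := by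
  have h := nonneg_of_hasDerivAt_nonpos_of_tendsto_zero (z := z)
    (H := fun t => scaledErfc t - Real.exp (-t ^ 2) * ((t ^ 1)⁻¹ - 1 / 2 * (t ^ 3)⁻¹))
    (H' := fun t => -Real.exp (-t ^ 2) * (3 / 2 * (t ^ 4)⁻¹)) (fun t ht => ?_) (fun t ht => ?_) ?_
  · have h2 : Real.exp (-z ^ 2) * (2 * z ^ 2 - 1) =
        2 * z ^ 3 * (Real.exp (-z ^ 2) * ((z ^ 1)⁻¹ - 1 / 2 * (z ^ 3)⁻¹)) := by field_simp
    rw [h2]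
    exact mul_le_mul_of_nonneg_left (by linarith) (by positivity)
  · have ht0 : 0 < t := hz.trans_le ht
    have hr := (hasDerivAt_inv_pow ht0 1).fun_sub ((hasDerivAt_inv_pow ht0 3).const_mul (1 / 2))
    refine ((hasDerivAt_scaledErfc t).fun_sub
      ((hasDerivAt_exp_neg_sq t).fun_mul hr)).congr_deriv ?_
    field_simp
    push_cast
    ring
  · rw [neg_mul, neg_nonpos]
    positivity
  · have hr := (tendsto_inv_pow_atTop one_ne_zero).sub
      ((tendsto_inv_pow_atTop three_ne_zero).const_mul (1 / 2))
    have hl := tendsto_scaledErfc.sub (tendsto_exp_neg_sq.mul hr)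
    rwa [zero_mul, sub_zero] at hl

/-- With `exp_neg_sq_mul_le_scaledErfc`, this encloses erfc between consecutive partial sums of its
series in 1/z - 1/(2z³) + 3/(4z⁵) - …. -/
theorem scaledErfc_le_exp_neg_sq_mul (hz : 0 < z) :
    2 * z ^ 3 * scaledErfc z ≤ Real.exp (-z ^ 2) * (2 * z ^ 2 - 1 + 3 / 2 * (z ^ 2)⁻¹) := by
  have h := nonneg_of_hasDerivAt_nonpos_of_tendsto_zero (z := z)
    (H := fun t => Real.exp (-t ^ 2) * ((t ^ 1)⁻¹ - 1 / 2 * (t ^ 3)⁻¹ + 3 / 4 * (t ^ 5)⁻¹) -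
      scaledErfc t)
    (H' := fun t => -Real.exp (-t ^ 2) * (15 / 4 * (t ^ 6)⁻¹)) (fun t ht => ?_) (fun t ht => ?_) ?_
  · have h2 : Real.exp (-z ^ 2) * (2 * z ^ 2 - 1 + 3 / 2 * (z ^ 2)⁻¹) = 2 * z ^ 3 *
        (Real.exp (-z ^ 2) * ((z ^ 1)⁻¹ - 1 / 2 * (z ^ 3)⁻¹ + 3 / 4 * (z ^ 5)⁻¹)) := by
      field_simp
      ring
    rw [h2]
    exact mul_le_mul_of_nonneg_left (by linarith) (by positivity)
  · have ht0 : 0 < t := hz.trans_le ht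
    have hr := ((hasDerivAt_inv_pow ht0 1).fun_sub
      ((hasDerivAt_inv_pow ht0 3).const_mul (1 / 2))).fun_add
      ((hasDerivAt_inv_pow ht0 5).const_mul (3 / 4))
    refine (((hasDerivAt_exp_neg_sq t).fun_mul hr).fun_sub
      (hasDerivAt_scaledErfc t)).congr_deriv ?_
    field_simp
    push_cast
    ring
  · rw [neg_mul, neg_nonpos]
    positivity
  · have hr := ((tendsto_inv_pow_atTop one_ne_zero).sub
      ((tendsto_inv_pow_atTop three_ne_zero).const_mul (1 / 2))).add
      ((tendsto_inv_pow_atTop (n := 5) (by norm_num)).const_mul (3 / 4))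
    have hl := (tendsto_exp_neg_sq.mul hr).sub tendsto_scaledErfc
    rwa [zero_mul, sub_zero] at hl

/-- The remainder of the first term of the asymptotic expansion of `scaledErfc`. -/
theorem scaledErfc_first_remainder (hz : 0 < z) :
    0 ≤ Real.exp (-z ^ 2) - z * scaledErfc z ∧
      Real.exp (-z ^ 2) - z * scaledErfc z ≤ scaledErfc z ∧
      Real.exp (-z ^ 2) - z * scaledErfc z ≤ scaledErfc z / z := by
  have h1 := mul_scaledErfc_le hz
  have h2 := exp_neg_sq_le_one_add_mul_scaledErfc hz.le
  have h3 := mul_exp_neg_sq_le_one_add_sq_mul_scaledErfc hz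
  refine ⟨by linarith, by linarith, ?_⟩
  rw [le_div_iff₀ hz]
  linarith

/-- The remainder of the first two terms of the asymptotic expansion of `scaledErfc`. -/
theorem scaledErfc_second_remainder (hz : 0 < z) :
    0 ≤ 2 * z ^ 3 * scaledErfc z - (2 * z ^ 2 - 1) * Real.exp (-z ^ 2) ∧
      2 * z ^ 3 * scaledErfc z - (2 * z ^ 2 - 1) * Real.exp (-z ^ 2) ≤ 3 * scaledErfc z ∧
      2 * z ^ 3 * scaledErfc z - (2 * z ^ 2 - 1) * Real.exp (-z ^ 2) ≤ 3 * scaledErfc z / z := by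
  have h1 := mul_scaledErfc_le hz
  have h2 := exp_neg_sq_le_one_add_mul_scaledErfc hz.le
  have h3 := exp_neg_sq_mul_le_scaledErfc hz
  have h4 := scaledErfc_le_exp_neg_sq_mul hz
  have hb := scaledErfc_pos z
  have key : (2 * z ^ 3 * scaledErfc z - (2 * z ^ 2 - 1) * Real.exp (-z ^ 2)) ≤ 3 * scaledErfc z ∧
      (2 * z ^ 3 * scaledErfc z - (2 * z ^ 2 - 1) * Real.exp (-z ^ 2)) * z ≤ 3 * scaledErfc z := by
    generalize Real.exp (-z ^ 2) = G at *
    generalize scaledErfc z = b at *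
    -- The truncated series is useless near 0. For z ≤ 1 the remainder is at most G ≤ (1 + z)b; for
    -- z ≥ 1 the next term of the series bounds it.
    rcases le_total z 1 with hz1 | hz1
    · have h5 : 2 * z ^ 3 * b - (2 * z ^ 2 - 1) * G ≤ 2 * b := by
        have h6 : 2 * z ^ 2 * (z * b) ≤ 2 * z ^ 2 * G := by gcongr
        have h7 : z * b ≤ b := mul_le_of_le_one_left hb.le hz1
        nlinarith
      refine ⟨by linarith, ?_⟩
      calc _ ≤ 2 * b * z := by gcongr
        _ ≤ 2 * b * 1 := by gcongr
        _ ≤ _ := by linarith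
    · have h5 : (2 * z ^ 3 * b - (2 * z ^ 2 - 1) * G) ≤ 3 / 2 * G * (z ^ 2)⁻¹ := by linarith
      have h6 : (2 * z ^ 3 * b - (2 * z ^ 2 - 1) * G) * z ≤ 3 * b := by
        calc _ ≤ 3 / 2 * G * (z ^ 2)⁻¹ * z := by gcongr
          _ = 3 / 2 * G / z := by field_simp
          _ ≤ 3 * b := by
            rw [div_le_iff₀ hz]
            nlinarith
      refine ⟨?_, h6⟩
      refine le_trans ?_ h6
      exact le_mul_of_one_le_right (by linarith) hz1
  refine ⟨by linarith, key.1, ?_⟩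
  rw [le_div_iff₀ hz]
  exact key.2

end

/-! ### Matching the closed formulas with the main terms. -/

section

variable {γ δ T x c q k b G : ℝ}

theorem integral_angle_eq_angularIntegral (hγ0 : 0 < γ) (hc0 : 0 < c)
    (hc : c ^ 2 = (1 - γ) / (2 * γ)) (hx : x = T * γ / 2) :
    ∫ ψ in (-Real.pi)..Real.pi,
        Real.exp (-(T / 2) * (1 - γ * Real.cos ψ)) / (1 - γ * Real.cos ψ) =
      Real.exp (-(2 * x * c ^ 2)) / γ * angularIntegral x c := by
  rw [angularIntegral, ← mul_assoc, ← intervalIntegral.integral_const_mul]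
  refine intervalIntegral.integral_congr fun ψ _ => ?_
  have h1 : 1 - γ * Real.cos ψ = 2 * γ * (c ^ 2 + Real.sin (ψ / 2) ^ 2) := by
    have h2 : Real.cos ψ = 1 - 2 * Real.sin (ψ / 2) ^ 2 := by
      rw [Real.sin_sq_eq_half_sub, mul_div_cancel₀ ψ two_ne_zero]; ring
    rw [h2, hc]
    field_simp
    ring
  have h3 : -(T / 2) * (2 * γ * (c ^ 2 + Real.sin (ψ / 2) ^ 2)) =
      -(2 * x * c ^ 2) + -2 * x * Real.sin (ψ / 2) ^ 2 := by rw [hx]; ring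
  have h4 : c ^ 2 + Real.sin (ψ / 2) ^ 2 ≠ 0 := by positivity
  simp only [h1, h3, Real.exp_add, lorentzGauss]
  field_simp

/-- Both squares equal (1 + δ)/γ. The coefficient of erfc in P₀ thereby splits into the Laplace
coefficient δ/(2γc) and a correction c that pairs with the exponential term. -/
theorem sqrt_div_one_sub (hγ0 : 0 < γ) (hδ0 : 0 < δ) (hδ1 : δ < 1) (hγδ : γ ^ 2 + δ ^ 2 = 1)
    (hc0 : 0 < c) (hc : c ^ 2 = (1 - γ) / (2 * γ)) :
    Real.sqrt (γ / (1 - δ)) = δ / (2 * γ * c) + c := by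
  have h1 : 0 < 1 - δ := by linarith
  rw [Real.sqrt_eq_iff_mul_self_eq (by positivity) (by positivity)]
  have h2 : (δ / (2 * γ * c) + c) * (δ / (2 * γ * c) + c) =
      δ ^ 2 / (4 * γ ^ 2 * c ^ 2) + δ / γ + c ^ 2 := by
    field_simp
    ring
  have h3 : 1 - γ ≠ 0 := by
    intro h0
    rw [h0, zero_div] at hc
    exact (pow_pos hc0 2).ne' hc
  have h4 : δ ^ 2 = (1 - γ) * (1 + γ) := by linear_combination hγδ
  have h5 : δ ^ 2 / (4 * γ ^ 2 * ((1 - γ) / (2 * γ))) = (1 + γ) / (2 * γ) := by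
    rw [h4]; field_simp; ring
  rw [h2, hc, h5]
  field_simp
  linear_combination 2 * hγδ

/-- Here k, q, b, G stand for √π, √(2x), `scaledErfc z` and exp(-z²), with z = cq. -/
theorem zeroth_sub_main (hγ0 : 0 < γ) (hc0 : 0 < c) (hq : 0 < q) (hk : 0 < k) :
    1 / 2 * (δ / (2 * γ * c) + c) * (b / k) - 1 / (2 * (k * q)) * G - δ * b / (4 * γ * c * k) =
      -(1 / (2 * k * q)) * (G - c * q * b) := by
  field_simp
  ring

theorem first_sub_main (hγ0 : 0 < γ) (hc0 : 0 < c) (hq : 0 < q) (hk : 0 < k)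
    (hc : c ^ 2 = (1 - γ) / (2 * γ)) :
    (1 / 2 * (δ / (2 * γ * c) + c) - c / 8 * ((1 + δ) / γ + 3)) * (b / k) +
        1 / (8 * k) * (2 * c * (δ / (2 * γ * c) + c) * q⁻¹ - (q ^ 3)⁻¹) * G -
        (δ * b / (4 * γ * c * k) * (1 - c ^ 2 / 2) + δ * G / (8 * γ * k * q)) =
      -(1 / (8 * k * q ^ 3)) *
        (2 * (c * q) ^ 3 * b - (2 * (c * q) ^ 2 - 1) * G) := by
  have h1 : 1 / γ = 1 + 2 * c ^ 2 := by rw [hc]; field_simp; ring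
  have h2 : (1 + δ) / γ = (1 + δ) * (1 + 2 * c ^ 2) := by rw [← h1]; ring
  have h3 : δ / (2 * γ * c) = δ * (1 + 2 * c ^ 2) / (2 * c) := by rw [← h1]; field_simp
  have h4 : δ * b / (4 * γ * c * k) = δ * (1 + 2 * c ^ 2) * b / (4 * c * k) := by
    rw [← h1]; field_simp
  have h5 : δ * G / (8 * γ * k * q) = δ * (1 + 2 * c ^ 2) * G / (8 * k * q) := by
    rw [← h1]; field_simp
  rw [h2, h3, h4, h5]
  field_simp
  ring

/-- The common error scale of the approximations. -/
noncomputable def errorScale (γ x : ℝ) : ℝ :=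
  min (1 / Real.sqrt x) (1 / (x * Real.sqrt (1 - γ)))

theorem errorScale_eq (hγ1 : γ < 1) (hx : 0 < x) :
    min (x ^ (-(1 / 2) : ℝ)) ((1 - γ) ^ (-(1 / 2) : ℝ) * x ^ (-1 : ℝ)) = errorScale γ x := by
  unfold errorScale
  rw [Real.rpow_neg hx.le, Real.rpow_neg (by linarith), ← Real.sqrt_eq_rpow, ← Real.sqrt_eq_rpow,
    Real.rpow_neg_one, one_div, one_div, mul_inv, mul_comm x⁻¹]

theorem errorScale_div_eq (hγ1 : γ < 1) (hx : 0 < x) :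
    min (x ^ (-(3 / 2) : ℝ)) ((1 - γ) ^ (-(1 / 2) : ℝ) * x ^ (-2 : ℝ)) =
      errorScale γ x * x⁻¹ := by
  rw [← errorScale_eq hγ1 hx, min_mul_of_nonneg _ _ (by positivity), ← Real.rpow_neg_one,
    ← Real.rpow_add hx, mul_assoc, ← Real.rpow_add hx]
  norm_num

/-- Lets the error scale absorb the Laplace error 1/x. -/
theorem inv_le_errorScale (hγ0 : 0 < γ) (hγ1 : γ < 1) (hx : 1 ≤ x) : x⁻¹ ≤ errorScale γ x := by
  have hx0 : 0 < x := by linarith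
  have h1 : 0 < Real.sqrt (1 - γ) := Real.sqrt_pos.2 (by linarith)
  have h2 : Real.sqrt (1 - γ) ≤ 1 := by rw [Real.sqrt_le_left zero_le_one]; linarith
  have h3 : Real.sqrt x ≤ x := by rw [Real.sqrt_le_left hx0.le]; nlinarith
  rw [inv_eq_one_div]
  refine le_min ?_ ?_
  · have := Real.sqrt_pos.2 hx0
    gcongr
  · gcongr
    exact mul_le_of_le_one_right hx0.le h2

/-- A quantity bounded by `b` and by `b / z` is small relative to the main term. -/
theorem remainder_le_main_mul_errorScale {B : ℝ} (hγ0 : 0 < γ) (hγ1 : γ < 1) (hδ0 : 0 < δ)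
    (hγδ : γ ^ 2 + δ ^ 2 = 1) (hc0 : 0 < c) (hc : c ^ 2 = (1 - γ) / (2 * γ)) (hx0 : 0 < x)
    (hq0 : 0 < q) (hq : q ^ 2 = 2 * x) (hk : 0 < k) (hb : 0 < b) (hB1 : B ≤ b)
    (hB2 : B ≤ b / (c * q)) :
    1 / (2 * k * q) * B ≤ δ * b / (4 * γ * c * k) * errorScale γ x := by
  have h1 : 0 < 1 - γ := by linarith
  have he0 : 0 < Real.sqrt (1 - γ) := Real.sqrt_pos.2 h1
  have he : Real.sqrt (1 - γ) ^ 2 = 1 - γ := Real.sq_sqrt h1.le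
  have hM : 0 ≤ δ * b / (4 * γ * c * k) := by positivity
  -- This bound and `hed` keep the comparison with the main term uniform as γ tends to 0 or 1; each
  -- yields one entry of the minimum.
  have hcd : 2 * γ * c ≤ δ := by
    refine abs_le_of_sq_le_sq' ?_ hδ0.le |>.2
    rw [mul_pow, hc]
    have : (2 * γ) ^ 2 * ((1 - γ) / (2 * γ)) = 2 * γ * (1 - γ) := by field_simp
    rw [this]
    nlinarith
  have hed : γ * Real.sqrt (1 - γ) ≤ δ := by
    refine abs_le_of_sq_le_sq' ?_ hδ0.le |>.2
    rw [mul_pow, he]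
    nlinarith [mul_pos hγ0 h1, mul_pos (mul_pos hγ0 hγ0) hγ0]
  unfold errorScale
  rw [mul_min_of_nonneg _ _ hM]
  refine le_min ?_ ?_
  · have hxq : Real.sqrt x ≤ q := by
      rw [Real.sqrt_le_left hq0.le, hq]; linarith
    have hsx : 0 < Real.sqrt x := Real.sqrt_pos.2 hx0
    calc 1 / (2 * k * q) * B ≤ 1 / (2 * k * q) * b := by gcongr
      _ = (2 * γ * c) * b / (4 * γ * c * k) * (1 / q) := by field_simp; norm_num
      _ ≤ δ * b / (4 * γ * c * k) * (1 / Real.sqrt x) := by gcongr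
  · calc 1 / (2 * k * q) * B ≤ 1 / (2 * k * q) * (b / (c * q)) := by gcongr
      _ = b / (2 * k * c * q ^ 2) := by field_simp
      _ = (γ * Real.sqrt (1 - γ)) * b / (4 * γ * c * k) * (1 / (x * Real.sqrt (1 - γ))) := by
          rw [hq]; field_simp; norm_num
      _ ≤ δ * b / (4 * γ * c * k) * (1 / (x * Real.sqrt (1 - γ))) := by gcongr

end

/-- The relative errors of both approximations against a multiple of the angular integral. -/
theorem approx_errors {γ T x P : ℝ} (hγ0 : 0 < γ) (hγ1 : γ < 1) (hT : 0 < T) (hx : x = T * γ / 2)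
    (hx1 : 1 ≤ x)
    (hP : P = Real.sqrt (1 - γ ^ 2) / (4 * Real.pi) * ∫ ψ in (-Real.pi)..Real.pi,
      Real.exp (-(T / 2) * (1 - γ * Real.cos ψ)) / (1 - γ * Real.cos ψ)) :
    0 < P ∧ |zerothOrderApprox γ T - P| ≤ 145 * errorScale γ x * P ∧
      |firstOrderApprox γ T - P| ≤ 145 * (errorScale γ x * x⁻¹) * P := by
  have hpi := Real.pi_pos
  have hx0 : 0 < x := by linarith
  have h1γ : 0 < 1 - γ := by linarith
  have hδsq : 0 < 1 - γ ^ 2 := by nlinarith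
  have hδ0 : 0 < Real.sqrt (1 - γ ^ 2) := Real.sqrt_pos.2 hδsq
  have hγδ : γ ^ 2 + Real.sqrt (1 - γ ^ 2) ^ 2 = 1 := by rw [Real.sq_sqrt hδsq.le]; ring
  have hδ1 : Real.sqrt (1 - γ ^ 2) < 1 := by
    rw [Real.sqrt_lt' one_pos]; nlinarith
  have hcpos : 0 < (1 - γ) / (2 * γ) := by positivity
  obtain ⟨c, hc0, hc⟩ : ∃ c, 0 < c ∧ c ^ 2 = (1 - γ) / (2 * γ) :=
    ⟨_, Real.sqrt_pos.2 hcpos, Real.sq_sqrt hcpos.le⟩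
  rw [integral_angle_eq_angularIntegral hγ0 hc0 hc hx] at hP
  have hIpos := angularIntegral_pos hx1 hc0
  have hγT : γ * T = 2 * x := by rw [hx]; ring
  have hq : 0 < Real.sqrt (2 * x) := Real.sqrt_pos.2 (by positivity)
  have hq2 : Real.sqrt (2 * x) ^ 2 = 2 * x := Real.sq_sqrt (by positivity)
  have hk : 0 < Real.sqrt Real.pi := Real.sqrt_pos.2 hpi
  have hk2 : Real.sqrt Real.pi ^ 2 = Real.pi := Real.sq_sqrt hpi.le
  have hz0 : 0 < c * Real.sqrt (2 * x) := by positivity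
  have hz2 : (c * Real.sqrt (2 * x)) ^ 2 = 2 * x * c ^ 2 := by rw [mul_pow, hq2]; ring
  have hz : Real.sqrt T * Real.sqrt (1 - γ) / Real.sqrt 2 = c * Real.sqrt (2 * x) := by
    rw [← Real.sqrt_mul hT.le, ← Real.sqrt_div (by positivity),
      Real.sqrt_eq_iff_mul_self_eq (by positivity) hz0.le, ← sq, hz2, hc, hx]
    field_simp
  have hG : Real.exp (-(T * (1 - γ) / 2)) = Real.exp (-(c * Real.sqrt (2 * x)) ^ 2) := by
    rw [hz2, hc, hx]
    congr 1
    field_simp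
  have hρ := sqrt_div_one_sub hγ0 hδ0 hδ1 hγδ hc0 hc
  have h2c : Real.sqrt ((1 - γ) / γ) = Real.sqrt 2 * c := by
    rw [Real.sqrt_eq_iff_mul_self_eq (by positivity) (by positivity), mul_mul_mul_comm,
      Real.mul_self_sqrt zero_le_two, ← sq, hc]
    field_simp
  have h2cρ : Real.sqrt ((1 - γ) / (1 - Real.sqrt (1 - γ ^ 2))) =
      Real.sqrt 2 * c * (Real.sqrt (1 - γ ^ 2) / (2 * γ * c) + c) := by
    have h1δ : 0 < 1 - Real.sqrt (1 - γ ^ 2) := by linarith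
    rw [← hρ, ← h2c, ← Real.sqrt_mul (by positivity)]
    congr 1
    field_simp
  have hπγT : Real.sqrt (Real.pi * γ * T) = Real.sqrt Real.pi * Real.sqrt (2 * x) := by
    rw [mul_assoc, hγT, Real.sqrt_mul hpi.le]
  have hr1 : (γ * T) ^ (-(1 / 2) : ℝ) = (Real.sqrt (2 * x))⁻¹ := by
    rw [hγT, Real.rpow_neg (by positivity), ← Real.sqrt_eq_rpow]
  have hr3 : (γ * T) ^ (-(3 / 2) : ℝ) = (Real.sqrt (2 * x) ^ 3)⁻¹ := by
    rw [hγT, Real.rpow_neg (by positivity), Real.sqrt_eq_rpow, ← Real.rpow_natCast,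
      ← Real.rpow_mul (by positivity)]
    norm_num
  have hs2 : Real.sqrt 2 ≠ 0 := by positivity
  have hs22 : Real.sqrt 2 * Real.sqrt 2 = 2 := Real.mul_self_sqrt zero_le_two
  -- the approximations and the main terms in normalized variables
  have hB1 := scaledErfc_first_remainder hz0
  have hB3 := scaledErfc_second_remainder hz0
  have hb := scaledErfc_pos (c * Real.sqrt (2 * x))
  have hA0 := integral_lorentzGauss hx0 hc0
  have hE1 := abs_angularIntegral_sub_integral_le hx1 hc0 (Or.inl rfl) arcsineWeight_one
  have hE2 := abs_angularIntegral_sub_integral_le hx1 hc0 (Or.inr rfl) arcsineWeight_two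
  rw [integral_lorentzGauss_mul_weight hx0 hc0] at hE2
  simp only [mul_one] at hE1
  have hGG : Real.exp (-(2 * x * c ^ 2)) * Real.exp (2 * x * c ^ 2) = 1 := by
    rw [← Real.exp_add, neg_add_cancel, Real.exp_zero]
  have hP0 : zerothOrderApprox γ T = 1 / 2 * (Real.sqrt (1 - γ ^ 2) / (2 * γ * c) + c) *
      (scaledErfc (c * Real.sqrt (2 * x)) / Real.sqrt Real.pi) -
      1 / (2 * (Real.sqrt Real.pi * Real.sqrt (2 * x))) *
        Real.exp (-(c * Real.sqrt (2 * x)) ^ 2) := by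
    simp only [zerothOrderApprox]
    rw [hz, hρ, hπγT, hG, erfc_eq_scaledErfc_div]
  have hP1 : firstOrderApprox γ T = (1 / 2 * (Real.sqrt (1 - γ ^ 2) / (2 * γ * c) + c) -
        c / 8 * ((1 + Real.sqrt (1 - γ ^ 2)) / γ + 3)) *
        (scaledErfc (c * Real.sqrt (2 * x)) / Real.sqrt Real.pi) +
      1 / (8 * Real.sqrt Real.pi) * (2 * c * (Real.sqrt (1 - γ ^ 2) / (2 * γ * c) + c) *
        (Real.sqrt (2 * x))⁻¹ - (Real.sqrt (2 * x) ^ 3)⁻¹) *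
        Real.exp (-(c * Real.sqrt (2 * x)) ^ 2) := by
    simp only [firstOrderApprox]
    rw [hz, hρ, hG, erfc_eq_scaledErfc_div, h2c, h2cρ, hr1, hr3]
    have e1 : Real.sqrt 2 * c * (1 / (8 * Real.sqrt 2)) = c / 8 := by field_simp
    rw [e1, ← mul_assoc (Real.sqrt 2), ← mul_assoc (Real.sqrt 2), hs22]
  rw [← hz2] at hA0 hP hGG
  rw [erfc_eq_scaledErfc_div] at hA0
  have hS0 := zeroth_sub_main (δ := Real.sqrt (1 - γ ^ 2))
    (b := scaledErfc (c * Real.sqrt (2 * x))) (G := Real.exp (-(c * Real.sqrt (2 * x)) ^ 2))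
    hγ0 hc0 hq hk
  have hS1 := first_sub_main (δ := Real.sqrt (1 - γ ^ 2))
    (b := scaledErfc (c * Real.sqrt (2 * x))) (G := Real.exp (-(c * Real.sqrt (2 * x)) ^ 2))
    hγ0 hc0 hq hk hc
  rw [← hP0] at hS0
  rw [← hP1] at hS1
  have hR0 := remainder_le_main_mul_errorScale hγ0 hγ1 hδ0 hγδ hc0 hc hx0 hq hq2 hk hb hB1.2.1
    hB1.2.2
  -- Division by 3 normalizes the second remainder, whose bounds carry that factor.
  have hR1 := remainder_le_main_mul_errorScale
    (B := (2 * (c * Real.sqrt (2 * x)) ^ 3 * scaledErfc (c * Real.sqrt (2 * x)) -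
      (2 * (c * Real.sqrt (2 * x)) ^ 2 - 1) * Real.exp (-(c * Real.sqrt (2 * x)) ^ 2)) / 3)
    hγ0 hγ1 hδ0 hγδ hc0 hc hx0 hq hq2 hk hb (by linarith [hB3.2.1]) (by
      have := hB3.2.2; rw [mul_div_assoc] at this; linarith)
  have hm := inv_le_errorScale hγ0 hγ1 hx1
  clear hP0 hP1 hρ h2c h2cρ hπγT hr1 hr3 hz hG hs2 hs22
  have hGpos := Real.exp_pos (-(c * Real.sqrt (2 * x)) ^ 2)
  generalize hZ : c * Real.sqrt (2 * x) = z at *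
  generalize Real.sqrt (1 - γ ^ 2) = δ at *
  generalize scaledErfc z = b at *
  generalize angularIntegral x c = I at *
  generalize Real.exp (z ^ 2) = G' at *
  generalize Real.exp (-z ^ 2) = G at *
  generalize Real.sqrt (2 * x) = q at *
  generalize Real.sqrt Real.pi = k at *
  generalize zerothOrderApprox γ T = P0 at *
  generalize firstOrderApprox γ T = P1 at *
  generalize errorScale γ x = m at *
  have hp : 0 < δ / (4 * Real.pi * γ) * G := by positivity
  have hPI : P = δ / (4 * Real.pi * γ) * G * I := by rw [hP]; field_simp
  have hPpos : 0 < P := by rw [hPI]; positivity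
  have hM : δ * b / (4 * γ * c * k) =
      δ / (4 * Real.pi * γ) * G * ∫ u, lorentzGauss x c u := by
    rw [hA0]
    calc δ * b / (4 * γ * c * k) = δ * b / (4 * γ * c * k) * (G * G') := by rw [hGG, mul_one]
      _ = _ := by field_simp
  have hM1 : δ * b / (4 * γ * c * k) * (1 - c ^ 2 / 2) + δ * G / (8 * γ * k * q) =
      δ / (4 * Real.pi * γ) * G *
        ((1 - c ^ 2 / 2) * (∫ u, lorentzGauss x c u) + 1 / 2 * (k / q)) := by
    rw [hM, ← hk2]
    field_simp
    ring
  have hD0 : |P - δ * b / (4 * γ * c * k)| ≤ 72 * x⁻¹ * P := by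
    rw [hM, hPI, ← mul_sub, abs_mul, abs_of_pos hp]
    calc _ ≤ δ / (4 * Real.pi * γ) * G * (72 / x ^ 1 * I) := by gcongr
      _ = _ := by rw [pow_one]; ring
  have hD1 : |P - (δ * b / (4 * γ * c * k) * (1 - c ^ 2 / 2) + δ * G / (8 * γ * k * q))| ≤
      72 * (x⁻¹ * x⁻¹) * P := by
    rw [hM1, hPI, ← mul_sub, abs_mul, abs_of_pos hp]
    calc _ ≤ δ / (4 * Real.pi * γ) * G * (72 / x ^ 2 * I) := by gcongr
      _ = _ := by rw [← mul_inv, ← sq]; ring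
  have hxi : 0 < x⁻¹ := inv_pos.2 hx0
  have hm0 : 0 < m := hxi.trans_le hm
  -- M ≤ P + 72P/x ≤ 73P, so errors relative to the main term become errors relative to P; then 145
  -- = 73 + 72.
  have hMP : δ * b / (4 * γ * c * k) ≤ 73 * P := by
    have h1 := (abs_le.1 hD0).1
    have h2 : 72 * x⁻¹ * P ≤ 72 * 1 * P := by
      gcongr
      exact inv_le_one_of_one_le₀ hx1
    linarith
  have hMpos : 0 < δ * b / (4 * γ * c * k) := by positivity
  generalize δ * b / (4 * γ * c * k) = M at *
  have hMm : M * m ≤ 73 * P * m := by gcongr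
  refine ⟨hPpos, ?_, ?_⟩
  · have h1 : |P0 - M| ≤ M * m := by
      rw [hS0, abs_mul, abs_neg, abs_of_nonneg hB1.1, abs_of_pos (by positivity)]
      exact hR0
    have h2 : 72 * x⁻¹ * P ≤ 72 * m * P := by gcongr
    calc |P0 - P| = |(P0 - M) - (P - M)| := by congr 1; ring
      _ ≤ |P0 - M| + |P - M| := abs_sub _ _
      _ ≤ 145 * m * P := by linarith
  · generalize M * (1 - c ^ 2 / 2) + δ * G / (8 * γ * k * q) = M1 at *
    have h1 : |P1 - M1| ≤ M * m * x⁻¹ := by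
      rw [hS1, abs_mul, abs_neg, abs_of_nonneg hB3.1, abs_of_pos (by positivity)]
      generalize hB : 2 * z ^ 3 * b - (2 * z ^ 2 - 1) * G = B at *
      -- The extra factor q² = 2x in the denominator supplies the additional 1/x of the first order.
      have h3 : 1 / (8 * k * q ^ 3) * B = 3 / 8 * (1 / (2 * k * q) * (B / 3)) * x⁻¹ := by
        have : q ^ 3 = 2 * x * q := by rw [← hq2]; ring
        rw [this]
        field_simp
      have h4 : 0 ≤ 1 / (2 * k * q) * (B / 3) := by
        have := hB3.1
        positivity
      rw [h3]
      exact mul_le_mul_of_nonneg_right (by linarith) hxi.le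
    have h2 : 72 * (x⁻¹ * x⁻¹) * P ≤ 72 * (m * x⁻¹) * P := by gcongr
    have h3 : M * m * x⁻¹ ≤ 73 * P * m * x⁻¹ := by gcongr
    calc |P1 - P| = |(P1 - M1) - (P - M1)| := by congr 1; ring
      _ ≤ |P1 - M1| + |P - M1| := abs_sub _ _
      _ ≤ 145 * (m * x⁻¹) * P := by linarith

theorem corollary2 :
    ∃ C X : ℝ, 0 < C ∧ 0 < X ∧
      ∀ (N : ℕ) (s s' : EuclideanSpace ℂ (Fin N)) (σ γ γs x : ℝ),
        ‖s‖ = 1 → ‖s'‖ = 1 → 0 < σ →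
        γ = ‖inner ℂ s s'‖ → 0 < γ → γ < 1 →
        γs = symbolSNR σ → x = γs * γ / 2 → X ≤ x →
          0 < pairwiseErrorProb σ s s' ∧
          |zerothOrderApprox γ γs / pairwiseErrorProb σ s s' - 1|
            ≤ C * min (x ^ (-(1 / 2) : ℝ)) ((1 - γ) ^ (-(1 / 2) : ℝ) * x ^ (-1 : ℝ)) ∧
          |firstOrderApprox γ γs / pairwiseErrorProb σ s s' - 1|
            ≤ C * min (x ^ (-(3 / 2) : ℝ)) ((1 - γ) ^ (-(1 / 2) : ℝ) * x ^ (-2 : ℝ)) := by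
  refine ⟨145, 1, by norm_num, one_pos, ?_⟩
  intro N s s' σ γ γs x hs hs' hσ hγ hγ0 hγ1 hγs hx hx1
  have hδ : 0 < 1 - γ ^ 2 := by nlinarith
  have hP := pairwiseErrorProb_eq_integral hs hs' hσ hγ hγ0 (Real.sqrt_pos.2 hδ)
    (by rw [Real.sq_sqrt hδ.le]; ring)
  rw [← hγs] at hP
  obtain ⟨hpos, h0, h1⟩ := approx_errors hγ0 hγ1 (hγs ▸ symbolSNR_pos hσ) hx hx1 hP
  have hx0 : 0 < x := by linarith
  refine ⟨hpos, ?_, ?_⟩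
  · rw [errorScale_eq hγ1 hx0, div_sub_one hpos.ne', abs_div, abs_of_pos hpos, div_le_iff₀ hpos]
    exact h0
  · rw [errorScale_div_eq hγ1 hx0, div_sub_one hpos.ne', abs_div, abs_of_pos hpos,
      div_le_iff₀ hpos]
    exact h1
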